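/- For $c=(c_1,c_2,c_3)\in\mathbb{R}^3$ consider on $(-1,1)$ the equation $$(1-x^2)U'+2xU+\tfrac12U^2=P_c(x):=c_1(1-x)+c_2(1+x)+c_3(1-x^2).\qquad(*)$$ For $c_1,c_2\ge-1$ put $\bar c_3(c_1,c_2):=-\tfrac12\bigl(\sqrt{1+c_1}+\sqrt{1+c_2}\bigr)\bigl(\sqrt{1+c_1}+\sqrt{1+c_2}+2\bigr)$, and let $J:=\{c\in\mathbb{R}^3: c_1\ge-1,\ c_2\ge-1,\ c_3\ge\bar c_3(c_1,c_2)\}$. Let $U^{+}(c)(x)$ and $U^{-}(c)(x)$, $-1<x<1$, be the supremum and the infimum of $V(x)$ over all solutions $V$ of $(*)$ on $(-1,1)$, let $\gamma^\pm(c):=U^\pm(c)(0)$, and let $I:=\{(c,\gamma)\in\mathbb{R}^4: c\in J,\ \gamma^-(c)\le\gamma\le\gamma^+(c)\}$. **Theorem 1.2.** For $c\in J$ the functions $U^{+}(c)$ and $U^-(c)$ are themselves solutions of $(*)$ on $(-1,1)$, and $U^-(c)\le V\le U^+(c)$ for every solution $V$. For each $(c,\gamma)\in I$, equation $(*)$ has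 a unique solution $U^{c,\gamma}_\theta\in C^\infty(-1,1)\cap C^0[-1,1]$ with $U^{c,\gamma}_\theta(0)=\gamma$. Conversely, if $c\in\mathbb{R}^3$ and $V$ is any differentiable solution of $(*)$ on $(-1,1)$, then $(c,V(0))\in I$ and $V=U^{c,V(0)}_\theta$ on $(-1,1)$. In particular, a solution of $(*)$ on $(-1,1)$ exists only if $c_1,c_2\ge-1$, and there is none if $c_3<\bar c_3(c_1,c_2)$. Moreover, these are all the $(-1)$-homogeneous axisymmetric no-swirl solutions of the stationary Navier–Stokes equations $$-\Delta u+u\cdot\nabla u+\nabla p=0,\qquad \operatorname{div}u=0 \qquad(\mathrm{NS})$$ on $\mathbb{S}^2\setminus\{S,N\}$ ($S$, $N$ the south and north poles), in the following sense. Let $\Omega$ be $\mathbb{R}^3$ without the $x_3$-axis, with spherical coordinates $(r,\theta,\phi)$ and the frame $e_r,e_\theta,e_\phi$; $u=u_re_r+u_\theta e_\theta+u_\phi e_\phi$ is axisymmetric if $u_r,u_\theta,u_\phi$ do not depend on $\phi$, and no-swirl if $u_\phi=0$. A function $U$ on $(-1,1)$ generates $(u,p)$ on $\Omega$ if $u$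 is $(-1)$-homogeneous, $p$ is $(-2)$-homogeneous, and for $r=1$ $$u_\theta=\frac{U(\cos\theta)}{\sin\theta},\quad u_\phi=0,\quad u_r=-\frac{du_\theta}{d\theta}-u_\theta\cot\theta,\quad p=-\frac12\Bigl(\frac{d^2u_r}{d\theta^2}+(\cot\theta-u_\theta)\frac{du_r}{d\theta}+u_r^2+u_\theta^2\Bigr).$$ Then for every $(c,\gamma)\in I$ the pair $(u,p)$ generated by $U^{c,\gamma}_\theta$ is an axisymmetric no-swirl solution of (NS) on $\Omega$ with $u$ and $p$ in $C^\infty(\Omega)$. Conversely, every solution $(u,p)$ of (NS) on $\Omega$ with $u\in C^2(\Omega)$ $(-1)$-homogeneous, axisymmetric and no-swirl, and $p\in C^1(\Omega)$ $(-2)$-homogeneous, is generated by $U^{c,\gamma}_\theta$ for some $(c,\gamma)\in I$. -/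

import Mathlib

open scoped ContDiff Laplacian Gradient

noncomputable section

namespace NSAxi

/-! ### The Riccati type equation -/

/-- `P_c(x) = c₁(1 - x) + c₂(1 + x) + c₃(1 - x²)`, where `c = (c₁, c₂, c₃)`. -/
def P (c : ℝ × ℝ × ℝ) (x : ℝ) : ℝ :=
  c.1 * (1 - x) + c.2.1 * (1 + x) + c.2.2 * (1 - x ^ 2)

/-- `U` is a solution on `(-1,1)` of `(1 - x²) U' + 2 x U + U² / 2 = P_c(x)`. Such a `U` is
automatically of class `C¹` (indeed smooth) on `(-1,1)`, because the equation can be solved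
for `U'`. Only the values of `U` on `(-1,1)` matter. -/
def IsRiccatiSolution (c : ℝ × ℝ × ℝ) (U : ℝ → ℝ) : Prop :=
  DifferentiableOn ℝ U (Set.Ioo (-1) 1) ∧
    ∀ x ∈ Set.Ioo (-1 : ℝ) 1,
      (1 - x ^ 2) * deriv U x + 2 * x * U x + 1 / 2 * U x ^ 2 = P c x

/-- `U ∈ C^∞(-1,1) ∩ C⁰[-1,1]` solves the equation with parameter `c` on `(-1,1)` and
`U(0) = γ`. -/
structure IsProfile (c : ℝ × ℝ × ℝ) (γ : ℝ) (U : ℝ → ℝ) : Prop where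
  smooth : ContDiffOn ℝ ∞ U (Set.Ioo (-1) 1)
  continuous : ContinuousOn U (Set.Icc (-1) 1)
  solution : IsRiccatiSolution c U
  value_zero : U 0 = γ

/-- `c̄₃(c₁, c₂)`, meant for `c₁, c₂ ≥ -1`. -/
def cbar (c₁ c₂ : ℝ) : ℝ :=
  -(1 / 2) * (Real.sqrt (1 + c₁) + Real.sqrt (1 + c₂)) *
    (Real.sqrt (1 + c₁) + Real.sqrt (1 + c₂) + 2)

/-- The parameter set `J ⊆ ℝ³`. -/
def J : Set (ℝ × ℝ × ℝ) :=
  {c | -1 ≤ c.1 ∧ -1 ≤ c.2.1 ∧ cbar c.1 c.2.1 ≤ c.2.2}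

/-- `U⁺(c)(x)`, `-1 < x < 1`: the pointwise supremum of all solutions on `(-1,1)`. -/
def Uplus (c : ℝ × ℝ × ℝ) (x : ℝ) : ℝ :=
  sSup {y | ∃ V : ℝ → ℝ, IsRiccatiSolution c V ∧ V x = y}

/-- `U⁻(c)(x)`, `-1 < x < 1`: the pointwise infimum of all solutions on `(-1,1)`. -/
def Uminus (c : ℝ × ℝ × ℝ) (x : ℝ) : ℝ :=
  sInf {y | ∃ V : ℝ → ℝ, IsRiccatiSolution c V ∧ V x = y}

/-- `γ⁺(c) = U⁺(c)(0)`. -/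
def gammaPlus (c : ℝ × ℝ × ℝ) : ℝ := Uplus c 0

/-- `γ⁻(c) = U⁻(c)(0)`. -/
def gammaMinus (c : ℝ × ℝ × ℝ) : ℝ := Uminus c 0

/-- The four-dimensional parameter set `I ⊆ ℝ⁴`, whose points are written `(c, γ)`. -/
def I : Set ((ℝ × ℝ × ℝ) × ℝ) :=
  {q | q.1 ∈ J ∧ gammaMinus q.1 ≤ q.2 ∧ q.2 ≤ gammaPlus q.1}

/-! ### The stationary Navier-Stokes equations -/

/-- Euclidean space `ℝ³`. -/
abbrev E := EuclideanSpace ℝ (Fin 3)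

/-- `ℝ³` without the `x₃`-axis, that is, the open cone over the unit sphere minus its two
poles. -/
def Domain : Set E := {x | x 0 ≠ 0 ∨ x 1 ≠ 0}

/-- `e_r` at the point with spherical angles `θ`, `φ`. -/
def er (θ φ : ℝ) : E :=
  !₂[Real.sin θ * Real.cos φ, Real.sin θ * Real.sin φ, Real.cos θ]

/-- `e_θ` at the point with spherical angles `θ`, `φ`. -/
def eθ (θ φ : ℝ) : E :=
  !₂[Real.cos θ * Real.cos φ, Real.cos θ * Real.sin φ, -Real.sin θ]

/-- `e_φ` at the point with spherical angles `θ`, `φ`. -/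
def eφ (_θ φ : ℝ) : E :=
  !₂[-Real.sin φ, Real.cos φ, 0]

/-- The component `u_r` of a vector field, in spherical coordinates. -/
def compR (u : E → E) (r θ φ : ℝ) : ℝ := inner ℝ (u (r • er θ φ)) (er θ φ)

/-- The component `u_θ` of a vector field, in spherical coordinates. -/
def compθ (u : E → E) (r θ φ : ℝ) : ℝ := inner ℝ (u (r • er θ φ)) (eθ θ φ)

/-- The component `u_φ` of a vector field, in spherical coordinates. -/
def compφ (u : E → E) (r θ φ : ℝ) : ℝ := inner ℝ (u (r • er θ φ)) (eφ θ φ)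

/-- The components `u_r`, `u_θ`, `u_φ` do not depend on `φ`. -/
def IsAxisymmetric (u : E → E) : Prop :=
  ∀ r > 0, ∀ θ ∈ Set.Ioo 0 Real.pi, ∀ φ φ' : ℝ,
    compR u r θ φ = compR u r θ φ' ∧ compθ u r θ φ = compθ u r θ φ' ∧
      compφ u r θ φ = compφ u r θ φ'

/-- `u_φ = 0`. -/
def IsNoSwirl (u : E → E) : Prop :=
  ∀ r > 0, ∀ θ ∈ Set.Ioo 0 Real.pi, ∀ φ : ℝ, compφ u r θ φ = 0

/-- The divergence of a vector field on `ℝ³`. -/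
def divergence (u : E → E) (x : E) : ℝ :=
  ∑ i : Fin 3, fderiv ℝ u x (EuclideanSpace.single i 1) i

/-- `(u, p)` is a classical (-1)-homogeneous axisymmetric no-swirl solution of
`-Δu + u·∇u + ∇p = 0`, `div u = 0` on `ℝ³` without the axis through the two poles: `u` is
(-1)-homogeneous of class `C²` and `p` is (-2)-homogeneous of class `C¹`. -/
structure IsNSSolution (u : E → E) (p : E → ℝ) : Prop where
  u_contDiffOn : ContDiffOn ℝ 2 u Domain
  p_contDiffOn : ContDiffOn ℝ 1 p Domain
  u_homogeneous : ∀ x ∈ Domain, ∀ l : ℝ, 0 < l → u (l • x) = l⁻¹ • u x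
  p_homogeneous : ∀ x ∈ Domain, ∀ l : ℝ, 0 < l → p (l • x) = (l ^ 2)⁻¹ * p x
  axisymmetric : IsAxisymmetric u
  noSwirl : IsNoSwirl u
  momentum : ∀ x ∈ Domain, -(Δ u) x + fderiv ℝ u x (u x) + ∇ p x = 0
  divFree : ∀ x ∈ Domain, divergence u x = 0

/-- `u_θ = U(cos θ) / sin θ` on the unit sphere. -/
def uθOf (U : ℝ → ℝ) (θ : ℝ) : ℝ := U (Real.cos θ) / Real.sin θ

/-- `u_r = -du_θ/dθ - u_θ cot θ` on the unit sphere. -/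
def urOf (U : ℝ → ℝ) (θ : ℝ) : ℝ := -deriv (uθOf U) θ - uθOf U θ * Real.cot θ

/-- `p = -(u_r'' + (cot θ - u_θ) u_r' + u_r² + u_θ²) / 2` on the unit sphere. -/
def pOf (U : ℝ → ℝ) (θ : ℝ) : ℝ :=
  -(1 / 2) * (deriv (deriv (urOf U)) θ + (Real.cot θ - uθOf U θ) * deriv (urOf U) θ +
    urOf U θ ^ 2 + uθOf U θ ^ 2)

/-- `(u, p)` is the pair of the (-1)-homogeneous axisymmetric no-swirl field and the
(-2)-homogeneous pressure on `Domain` that is determined by the profile `U`. -/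
def IsGeneratedBy (U : ℝ → ℝ) (u : E → E) (p : E → ℝ) : Prop :=
  ∀ r > 0, ∀ θ ∈ Set.Ioo 0 Real.pi, ∀ φ : ℝ,
    u (r • er θ φ) = r⁻¹ • (urOf U θ • er θ φ + uθOf U θ • eθ θ φ) ∧
      p (r • er θ φ) = (r ^ 2)⁻¹ * pOf U θ

end NSAxi

end

section

open Set Filter Topology

namespace NSAxi

/-! Relative to a known solution V₀ for c₀, the Riccati equation is linearised by V = V₀ + 2(1 - x²)
φ'/φ with φ > 0. If S'/S = V₀/(1 - x²), then Sφ' has derivative Sφ (P_c - P_{c₀}) / (2(1 - x²)²)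
(`hasDerivAt_wronskian`). For c = c₀ it is constant, so φ = 1 + k h with h' = 1/S, and solutions
correspond to the k for which 1 + k h stays positive on (-1,1) (`exists_solution_family`). These k
form a compact interval, which yields the greatest and least solutions, everything between them, and
uniqueness for a given value at 0.

Near 1, y = V + 2x satisfies (1 - x²) y' = 2 + P_c - y²/2. A right side at most -δ(1 + y²) would
send arctan y to -∞, which excludes c₂ < -1 and unbounded y; levels that can be crossed in one
direction only exclude oscillation (`exists_tendsto_left_of_one`). So V has a limit at 1, and by
reflection at -1.

With a = √(1 + c₁) and b = √(1 + c₂), the linear function `explicitSolution a b` solves the equation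
for c₃ = c̄₃. For smaller c₃ the Wronskian against it is strictly decreasing and drives the positive
φ to -∞ at a pole. For larger c₃ a solution comes from φ(x) = v((1 + x)/2), v a hypergeometric
series with positive coefficients.

For Navier-Stokes, u = A(cos θ) x/r² - B(cos θ) e_z/r with U = (1 - y²) B. Incompressibility
determines A. Since x and e_z are independent off the axis, the momentum equation for p = q(cos
θ)/r² says q = `pressureCoeff` and q' = `pressureSlope` (`momentum_iff`). The left side of the
Riccati equation is F = (1 - y²)² (B' + B²/2), and `pressureCoeff` = R - F''/2 with R' =
`pressureSlope`. Hence the momentum equation amounts to F''' = 0, that is, F = P_c for some c. -/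

theorem one_sub_sq_pos {x : ℝ} (hx : x ∈ Ioo (-1 : ℝ) 1) : 0 < 1 - x ^ 2 := by
  nlinarith [hx.1, hx.2]

/-! ### Regularity and reflection for the Riccati equation -/

theorem IsRiccatiSolution.hasDerivAt {c : ℝ × ℝ × ℝ} {U : ℝ → ℝ} (h : IsRiccatiSolution c U)
    {x : ℝ} (hx : x ∈ Ioo (-1 : ℝ) 1) :
    HasDerivAt U ((P c x - 2 * x * U x - 1 / 2 * U x ^ 2) / (1 - x ^ 2)) x := by
  have hd := ((h.1 x hx).differentiableAt (isOpen_Ioo.mem_nhds hx)).hasDerivAt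
  refine hd.congr_deriv ?_
  rw [← h.2 x hx, eq_div_iff (one_sub_sq_pos hx).ne']
  ring

theorem isRiccatiSolution_of_hasDerivAt {c : ℝ × ℝ × ℝ} {U : ℝ → ℝ}
    (h : ∀ x ∈ Ioo (-1 : ℝ) 1,
      HasDerivAt U ((P c x - 2 * x * U x - 1 / 2 * U x ^ 2) / (1 - x ^ 2)) x) :
    IsRiccatiSolution c U := by
  refine ⟨fun x hx => (h x hx).differentiableAt.differentiableWithinAt, fun x hx => ?_⟩
  rw [(h x hx).deriv, mul_div_cancel₀ _ (one_sub_sq_pos hx).ne']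
  ring

theorem IsRiccatiSolution.continuousOn {c : ℝ × ℝ × ℝ} {U : ℝ → ℝ}
    (h : IsRiccatiSolution c U) : ContinuousOn U (Ioo (-1) 1) := h.1.continuousOn

theorem IsRiccatiSolution.congr {c : ℝ × ℝ × ℝ} {U V : ℝ → ℝ} (h : IsRiccatiSolution c U)
    (hUV : EqOn V U (Ioo (-1) 1)) : IsRiccatiSolution c V := by
  refine ⟨h.1.congr hUV, fun x hx => ?_⟩
  rw [(hUV.eventuallyEq_of_mem (isOpen_Ioo.mem_nhds hx)).deriv_eq, hUV hx, h.2 x hx]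

/-- Bootstrapping: the equation expresses U' smoothly through x and U, so each order of regularity
gives the next. -/
theorem IsRiccatiSolution.contDiffOn {c : ℝ × ℝ × ℝ} {U : ℝ → ℝ}
    (h : IsRiccatiSolution c U) : ContDiffOn ℝ ∞ U (Ioo (-1) 1) := by
  rw [contDiffOn_infty]
  intro n
  induction n with
  | zero => exact contDiffOn_zero.2 h.continuousOn
  | succ n ih =>
    push_cast
    refine (contDiffOn_succ_iff_deriv_of_isOpen isOpen_Ioo).2 ⟨h.1, by simp, ?_⟩
    refine ContDiffOn.congr (f := fun x => (P c x - 2 * x * U x - 1 / 2 * U x ^ 2) / (1 - x ^ 2))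
      ?_ fun x hx => (h.hasDerivAt hx).deriv
    have hP : ContDiff ℝ n (P c) := by unfold P; fun_prop
    refine ContDiffOn.div ?_ (by fun_prop) fun x hx => (one_sub_sq_pos hx).ne'
    exact (hP.contDiffOn.sub (ContDiffOn.mul (by fun_prop) ih)).sub
      (contDiffOn_const.mul (ih.pow 2))

/-- The reflection `x ↦ -x` exchanges the two poles. -/
theorem IsRiccatiSolution.reflect {c : ℝ × ℝ × ℝ} {U : ℝ → ℝ} (h : IsRiccatiSolution c U) :
    IsRiccatiSolution (c.2.1, c.1, c.2.2) (fun x => -U (-x)) := by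
  refine isRiccatiSolution_of_hasDerivAt fun x hx => ?_
  have hx' : -x ∈ Ioo (-1 : ℝ) 1 := ⟨by linarith [hx.2], by linarith [hx.1]⟩
  have := ((h.hasDerivAt hx').scomp x (hasDerivAt_neg x)).neg
  refine this.congr_deriv ?_
  simp only [P, smul_eq_mul]
  ring

/-! ### Linearisation and the one-parameter family of solutions -/

theorem exists_antideriv {f : ℝ → ℝ} (hf : ContinuousOn f (Ioo (-1) 1)) :
    ∃ F : ℝ → ℝ, F 0 = 0 ∧ ∀ x ∈ Ioo (-1 : ℝ) 1, HasDerivAt F (f x) x := by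
  refine ⟨fun x => ∫ t in (0 : ℝ)..x, f t, by simp, fun x hx => ?_⟩
  have h0 : (0 : ℝ) ∈ Ioo (-1 : ℝ) 1 := by norm_num
  have hsub : uIcc 0 x ⊆ Ioo (-1 : ℝ) 1 := ordConnected_Ioo.uIcc_subset h0 hx
  refine intervalIntegral.integral_hasDerivAt_right (hf.mono hsub).intervalIntegrable ?_
    (hf.continuousAt (isOpen_Ioo.mem_nhds hx))
  exact hf.stronglyMeasurableAtFilter isOpen_Ioo _ hx

theorem eq_of_hasDerivAt_zero {f : ℝ → ℝ} (hf : ∀ y ∈ Ioo (-1 : ℝ) 1, HasDerivAt f 0 y) {x : ℝ}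
    (hx : x ∈ Ioo (-1 : ℝ) 1) : f x = f 0 := by
  refine (convex_Ioo (-1 : ℝ) 1).is_const_of_fderivWithin_eq_zero (𝕜 := ℝ)
    (fun y hy => (hf y hy).differentiableAt.differentiableWithinAt) (fun y hy => ?_) hx
    (by norm_num)
  rw [(hf y hy).hasFDerivAt.hasFDerivWithinAt.fderivWithin (isOpen_Ioo.uniqueDiffWithinAt hy)]
  ext
  simp

/-- A positive function with prescribed continuous logarithmic derivative. -/
theorem exists_logDeriv {f : ℝ → ℝ} (hf : ContinuousOn f (Ioo (-1) 1)) :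
    ∃ F : ℝ → ℝ, F 0 = 1 ∧ (∀ x, 0 < F x) ∧
      ∀ x ∈ Ioo (-1 : ℝ) 1, HasDerivAt F (F x * f x) x := by
  obtain ⟨G, hG0, hG⟩ := exists_antideriv hf
  exact ⟨fun x => Real.exp (G x), by simp [hG0], fun x => Real.exp_pos _,
    fun x hx => (hG x hx).exp⟩

theorem continuousOn_div_one_sub_sq {f : ℝ → ℝ} (hf : ContinuousOn f (Ioo (-1) 1)) (a : ℝ)
    (ha : a ≠ 0) : ContinuousOn (fun x => f x / (a * (1 - x ^ 2))) (Ioo (-1) 1) :=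
  hf.div (by fun_prop) fun _ hx => mul_ne_zero ha (one_sub_sq_pos hx).ne'

/-- The Wronskian identity for two equations of Riccati type. -/
theorem hasDerivAt_wronskian {c₀ c : ℝ × ℝ × ℝ} {V₀ V S φ : ℝ → ℝ} {x : ℝ}
    (hx : x ∈ Ioo (-1 : ℝ) 1) (h₀ : IsRiccatiSolution c₀ V₀) (h : IsRiccatiSolution c V)
    (hS : HasDerivAt S (S x * (V₀ x / (1 - x ^ 2))) x)
    (hφ : HasDerivAt φ (φ x * ((V x - V₀ x) / (2 * (1 - x ^ 2)))) x) :
    HasDerivAt (fun x => S x * (φ x * ((V x - V₀ x) / (2 * (1 - x ^ 2)))))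
      (S x * φ x * (P c x - P c₀ x) / (2 * (1 - x ^ 2) ^ 2)) x := by
  have hp := one_sub_sq_pos hx
  have hden : HasDerivAt (fun x : ℝ => 2 * (1 - x ^ 2)) (2 * (-(2 * x))) x := by
    simpa using ((hasDerivAt_pow 2 x).const_sub 1).const_mul 2
  have := hS.mul (hφ.mul (((h.hasDerivAt hx).sub (h₀.hasDerivAt hx)).div hden (by positivity)))
  refine this.congr_deriv ?_
  simp only [Pi.mul_apply, Pi.div_apply, Pi.sub_apply]
  field_simp
  ring

/-- All solutions are obtained from one of them by a one-parameter formula. -/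
theorem exists_solution_family {c : ℝ × ℝ × ℝ} {V₀ : ℝ → ℝ} (h₀ : IsRiccatiSolution c V₀) :
    ∃ h σ : ℝ → ℝ, h 0 = 0 ∧ σ 0 = 1 ∧ StrictMonoOn h (Ioo (-1) 1) ∧
      ContinuousOn h (Ioo (-1) 1) ∧ (∀ x, 0 < σ x) ∧
      (∀ k : ℝ, (∀ x ∈ Ioo (-1 : ℝ) 1, 0 < 1 + k * h x) →
        IsRiccatiSolution c
          (fun x => V₀ x + 2 * (1 - x ^ 2) * σ x * (k / (1 + k * h x)))) ∧
      ∀ V : ℝ → ℝ, IsRiccatiSolution c V → ∃ k : ℝ, ∀ x ∈ Ioo (-1 : ℝ) 1,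
        0 < 1 + k * h x ∧ V x = V₀ x + 2 * (1 - x ^ 2) * σ x * (k / (1 + k * h x)) := by
  have h0 : (0 : ℝ) ∈ Ioo (-1 : ℝ) 1 := by norm_num
  -- σ is the reciprocal of the integrating factor S, and h is its primitive.
  obtain ⟨σ, hσ0, hσpos, hσ⟩ := exists_logDeriv (f := fun x => -V₀ x / (1 * (1 - x ^ 2)))
    (continuousOn_div_one_sub_sq h₀.continuousOn.neg 1 one_ne_zero)
  have hσc : ContinuousOn σ (Ioo (-1) 1) := fun x hx =>
    (hσ x hx).continuousAt.continuousWithinAt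
  obtain ⟨h, hh0, hh⟩ := exists_antideriv hσc
  have hhc : ContinuousOn h (Ioo (-1) 1) := fun x hx =>
    (hh x hx).continuousAt.continuousWithinAt
  have hmono : StrictMonoOn h (Ioo (-1) 1) := by
    refine strictMonoOn_of_deriv_pos (convex_Ioo _ _) hhc fun x hx => ?_
    rw [interior_Ioo] at hx
    rw [(hh x hx).deriv]
    exact hσpos x
  refine ⟨h, σ, hh0, hσ0, hmono, hhc, hσpos, fun k hk => ?_, fun V hV => ?_⟩
  · refine isRiccatiSolution_of_hasDerivAt fun x hx => ?_
    have hp := one_sub_sq_pos hx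
    have hkx := hk x hx
    have hden : HasDerivAt (fun x : ℝ => 2 * (1 - x ^ 2)) (2 * (-(2 * x))) x := by
      simpa using ((hasDerivAt_pow 2 x).const_sub 1).const_mul 2
    have h1 := (((hh x hx).const_mul k).const_add 1)
    have := (h₀.hasDerivAt hx).add ((hden.mul (hσ x hx)).mul
      ((hasDerivAt_const x k).div h1 hkx.ne'))
    refine this.congr_deriv ?_
    simp only [Pi.mul_apply, Pi.div_apply]
    field_simp
    ring
  · obtain ⟨φ, hφ0, hφpos, hφ⟩ :=
      exists_logDeriv (f := fun x => (V x - V₀ x) / (2 * (1 - x ^ 2)))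
        (continuousOn_div_one_sub_sq (hV.continuousOn.sub h₀.continuousOn) 2 two_ne_zero)
    have hS : ∀ x ∈ Ioo (-1 : ℝ) 1,
        HasDerivAt (fun x => (σ x)⁻¹) ((σ x)⁻¹ * (V₀ x / (1 - x ^ 2))) x := fun x hx => by
      refine ((hσ x hx).inv (hσpos x).ne').congr_deriv ?_
      have := one_sub_sq_pos hx
      have := hσpos x
      field_simp
    set G := fun x => (σ x)⁻¹ * (φ x * ((V x - V₀ x) / (2 * (1 - x ^ 2)))) with hG
    have hGconst : ∀ x ∈ Ioo (-1 : ℝ) 1, G x = G 0 := fun x hx => by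
      refine eq_of_hasDerivAt_zero (fun y hy => ?_) hx
      have := hasDerivAt_wronskian hy h₀ hV (hS y hy) (hφ y hy)
      simpa only [sub_self, mul_zero, zero_div] using this
    set k := G 0 with hk
    -- The constant Wronskian k gives φ' = k σ = (k h)'.
    have hφeq : ∀ x ∈ Ioo (-1 : ℝ) 1, φ x = 1 + k * h x := fun x hx => by
      have hd : ∀ y ∈ Ioo (-1 : ℝ) 1, HasDerivAt (fun y => φ y - k * h y) 0 y := fun y hy => by
        refine ((hφ y hy).sub ((hh y hy).const_mul k)).congr_deriv ?_
        rw [← hGconst y hy, hG]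
        have := hσpos y
        field_simp
        ring
      have : φ x - k * h x = φ 0 - k * h 0 := eq_of_hasDerivAt_zero hd hx
      rw [hφ0, hh0] at this
      linarith
    refine ⟨k, fun x hx => ?_⟩
    have h1 := hφpos x
    rw [← hφeq x hx]
    refine ⟨h1, ?_⟩
    rw [← hGconst x hx, hG]
    have := one_sub_sq_pos hx
    have := hσpos x
    field_simp
    ring

/-! ### Limits at the poles -/

theorem eventually_left_of_one {p : ℝ → Prop} (h : ∀ᶠ x in 𝓝[<] (1 : ℝ), p x) :
    ∃ a ∈ Ico (0 : ℝ) 1, ∀ x ∈ Ico a 1, p x := by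
  obtain ⟨l, hl, hlp⟩ := mem_nhdsLT_iff_exists_Ico_subset.1 h
  exact ⟨max l 0, ⟨le_max_right _ _, max_lt hl one_pos⟩,
    fun x hx => hlp ⟨(le_max_left _ _).trans hx.1, hx.2⟩⟩

theorem eventually_left_of_one_of_forall {p : ℝ → Prop} {a : ℝ} (ha : a < 1)
    (h : ∀ x ∈ Ico a 1, p x) : ∀ᶠ x in 𝓝[<] (1 : ℝ), p x :=
  mem_of_superset (Ico_mem_nhdsLT ha) h

/-- A function whose derivative is at most `-ε / (1 - x)` near `1` is not bounded below. -/
theorem false_of_deriv_le_neg_div {g g' : ℝ → ℝ} {a ε B : ℝ} (ha : a < 1) (hε : 0 < ε)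
    (hg : ∀ x ∈ Ico a 1, HasDerivAt g (g' x) x) (hg' : ∀ x ∈ Ico a 1, g' x ≤ -ε / (1 - x))
    (hB : ∀ x ∈ Ico a 1, B ≤ g x) : False := by
  have hd : ∀ x ∈ Ico a 1, HasDerivAt (fun x => g x - ε * Real.log (1 - x))
      (g' x - ε * (-1 / (1 - x))) x := fun x hx => (hg x hx).sub
      ((((hasDerivAt_id x).const_sub 1).log (by simpa using (sub_pos.2 hx.2).ne')).const_mul _)
  have hanti : AntitoneOn (fun x => g x - ε * Real.log (1 - x)) (Ico a 1) := by
    refine antitoneOn_of_deriv_nonpos (convex_Ico _ _)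
      (fun x hx => (hd x hx).continuousAt.continuousWithinAt)
      (fun x hx => (hd x (interior_subset hx)).differentiableAt.differentiableWithinAt)
      fun x hx => ?_
    have hx' := interior_subset hx
    rw [(hd x hx').deriv]
    have := hg' x hx'
    rw [neg_div] at this
    rw [neg_div, mul_neg, mul_one_div]
    linarith
  have hlog : Tendsto (fun x : ℝ => ε * Real.log (1 - x)) (𝓝[<] 1) atBot := by
    refine Tendsto.const_mul_atBot hε (Real.tendsto_log_nhdsGT_zero.comp ?_)
    refine tendsto_nhdsWithin_iff.2 ⟨?_, ?_⟩
    · have : Tendsto (fun x : ℝ => 1 - x) (𝓝 1) (𝓝 (1 - 1)) := by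
        exact tendsto_const_nhds.sub tendsto_id
      rw [sub_self] at this
      exact this.mono_left nhdsWithin_le_nhds
    · filter_upwards [self_mem_nhdsWithin] with x hx
      exact sub_pos.2 (mem_Iio.1 hx)
  obtain ⟨x, hx1, hx2⟩ := ((hlog.eventually_lt_atBot (B - (g a - ε * Real.log (1 - a)))).and
    (Ico_mem_nhdsLT ha)).exists
  have := hanti (left_mem_Ico.2 ha) hx2 hx2.1
  simp only at this
  linarith [hB x hx2]

section

variable {y Q : ℝ → ℝ} {L : ℝ}

/-- Near 1 the function Q stays below m²/2, so y' < 0 wherever y = m: the level m can be crossed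
only downwards. -/
theorem eventually_le_or_ge_of_lt
    (hy : ∀ x ∈ Ioo (-1 : ℝ) 1, HasDerivAt y ((Q x - y x ^ 2 / 2) / (1 - x ^ 2)) x)
    (hQ : Tendsto Q (𝓝[<] 1) (𝓝 L)) {m : ℝ} (hm : L < m ^ 2 / 2) :
    (∀ᶠ x in 𝓝[<] (1 : ℝ), y x ≤ m) ∨ ∀ᶠ x in 𝓝[<] (1 : ℝ), m ≤ y x := by
  obtain ⟨a, ha, hQa⟩ := eventually_left_of_one (hQ.eventually_lt_const hm)
  by_cases hex : ∃ b ∈ Ico a 1, y b ≤ m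
  · obtain ⟨b, hb, hyb⟩ := hex
    refine Or.inl (eventually_left_of_one_of_forall hb.2 fun x hx => ?_)
    have hsub : ∀ t ∈ Icc b x, t ∈ Ioo (-1 : ℝ) 1 := fun t ht =>
      ⟨by linarith [ht.1, hb.1, ha.1], by linarith [ht.2, hx.2]⟩
    refine image_le_of_deriv_right_lt_deriv_boundary' (B := fun _ => m) (B' := fun _ => 0)
      (fun t ht => (hy t (hsub t ht)).continuousAt.continuousWithinAt)
      (fun t ht => (hy t (hsub t (Ico_subset_Icc_self ht))).hasDerivWithinAt) hyb
      continuousOn_const (fun t _ => hasDerivWithinAt_const _ _ _) (fun t ht h => ?_)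
      (right_mem_Icc.2 hx.1)
    refine div_neg_of_neg_of_pos ?_ (one_sub_sq_pos (hsub t (Ico_subset_Icc_self ht)))
    rw [h]
    linarith [hQa t ⟨hb.1.trans ht.1, ht.2.trans hx.2⟩]
  · push Not at hex
    exact Or.inr (eventually_left_of_one_of_forall ha.2 fun x hx => (hex x hx).le)

/-- The opposite barrier: now y' > 0 wherever y = m near 1, so crossings go only upwards. -/
theorem eventually_le_or_ge_of_gt
    (hy : ∀ x ∈ Ioo (-1 : ℝ) 1, HasDerivAt y ((Q x - y x ^ 2 / 2) / (1 - x ^ 2)) x)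
    (hQ : Tendsto Q (𝓝[<] 1) (𝓝 L)) {m : ℝ} (hm : m ^ 2 / 2 < L) :
    (∀ᶠ x in 𝓝[<] (1 : ℝ), y x ≤ m) ∨ ∀ᶠ x in 𝓝[<] (1 : ℝ), m ≤ y x := by
  obtain ⟨a, ha, hQa⟩ := eventually_left_of_one (hQ.eventually_const_lt hm)
  by_cases hex : ∃ b ∈ Ico a 1, m ≤ y b
  · obtain ⟨b, hb, hyb⟩ := hex
    refine Or.inr (eventually_left_of_one_of_forall hb.2 fun x hx => ?_)
    have hsub : ∀ t ∈ Icc b x, t ∈ Ioo (-1 : ℝ) 1 := fun t ht =>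
      ⟨by linarith [ht.1, hb.1, ha.1], by linarith [ht.2, hx.2]⟩
    refine image_le_of_deriv_right_lt_deriv_boundary' (f := fun _ => m) (f' := fun _ => 0)
      continuousOn_const (fun t _ => hasDerivWithinAt_const _ _ _) hyb
      (fun t ht => (hy t (hsub t ht)).continuousAt.continuousWithinAt)
      (fun t ht => (hy t (hsub t (Ico_subset_Icc_self ht))).hasDerivWithinAt) (fun t ht h => ?_)
      (right_mem_Icc.2 hx.1)
    refine div_pos ?_ (one_sub_sq_pos (hsub t (Ico_subset_Icc_self ht)))
    rw [← h]
    linarith [hQa t ⟨hb.1.trans ht.1, ht.2.trans hx.2⟩]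
  · push Not at hex
    exact Or.inl (eventually_left_of_one_of_forall ha.2 fun x hx => (hex x hx).le)

/-- Otherwise arctan y would have derivative at most -δ/(1 - x²) ≤ -(δ/2)/(1 - x) near 1 and would
be unbounded below. -/
theorem not_eventually_le_neg
    (hy : ∀ x ∈ Ioo (-1 : ℝ) 1, HasDerivAt y ((Q x - y x ^ 2 / 2) / (1 - x ^ 2)) x)
    {δ : ℝ} (hδ : 0 < δ) :
    ¬ ∀ᶠ x in 𝓝[<] (1 : ℝ), Q x - y x ^ 2 / 2 ≤ -δ * (1 + y x ^ 2) := by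
  intro h
  obtain ⟨a, ha, hQa⟩ := eventually_left_of_one h
  have hsub : ∀ t ∈ Ico a 1, t ∈ Ioo (-1 : ℝ) 1 := fun t ht =>
    ⟨by linarith [ht.1, ha.1], ht.2⟩
  refine false_of_deriv_le_neg_div ha.2 (half_pos hδ)
    (fun x hx => (hy x (hsub x hx)).arctan) (fun x hx => ?_)
    (fun x _ => (Real.neg_pi_div_two_lt_arctan (y x)).le)
  have h1 : 0 < 1 - x := sub_pos.2 hx.2
  have h2 : 0 < 1 + x := by linarith [hx.1, ha.1]
  have h3 : 0 < 1 + y x ^ 2 := by positivity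
  have h4 : 1 / (1 + y x ^ 2) * ((Q x - y x ^ 2 / 2) / (1 - x ^ 2)) ≤ -δ / (1 - x ^ 2) := by
    rw [← mul_div_assoc]
    gcongr
    · exact (one_sub_sq_pos (hsub x hx)).le
    · rw [one_div, inv_mul_le_iff₀ h3]
      linarith [hQa x hx]
  refine h4.trans ?_
  rw [neg_div, neg_div, neg_le_neg_iff, div_div, div_le_div_iff_of_pos_left hδ (by positivity)
    (one_sub_sq_pos (hsub x hx))]
  nlinarith

theorem exists_tendsto_left_of_one
    (hy : ∀ x ∈ Ioo (-1 : ℝ) 1, HasDerivAt y ((Q x - y x ^ 2 / 2) / (1 - x ^ 2)) x)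
    (hQ : Tendsto Q (𝓝[<] 1) (𝓝 L)) :
    0 ≤ L ∧ ∃ l, Tendsto y (𝓝[<] 1) (𝓝 l) := by
  constructor
  · by_contra! hL
    refine not_eventually_le_neg hy (δ := min (-L / 2) (1 / 2))
      (lt_min (by linarith) (by norm_num)) ?_
    filter_upwards [hQ.eventually_lt_const (show L < L / 2 by linarith)] with x hx
    have h1 := min_le_left (-L / 2) (1 / 2)
    have h2 := min_le_right (-L / 2) (1 / 2)
    nlinarith [sq_nonneg (y x)]
  have hside : ∀ m : ℝ, m ^ 2 / 2 ≠ L →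
      (∀ᶠ x in 𝓝[<] (1 : ℝ), y x ≤ m) ∨ ∀ᶠ x in 𝓝[<] (1 : ℝ), m ≤ y x := fun m hm =>
    hm.lt_or_gt.elim (eventually_le_or_ge_of_gt hy hQ) (eventually_le_or_ge_of_lt hy hQ)
  -- M is large enough that M²/2 > L and that, near 1, y² ≥ M² forces Q - y²/2 ≤ -(1 + y²)/4, which
  -- cannot persist.
  set M := 2 * (|L| + 2) with hM
  have hMpos : 4 ≤ M := by linarith [abs_nonneg L]
  have hQM : ∀ᶠ x in 𝓝[<] (1 : ℝ), Q x < M / 2 - 1 :=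
    hQ.eventually_lt_const (by linarith [le_abs_self L])
  have hfar : ¬ ∀ᶠ x in 𝓝[<] (1 : ℝ), M ^ 2 ≤ y x ^ 2 := fun h => by
    refine not_eventually_le_neg hy (δ := 1 / 4) (by norm_num) ?_
    filter_upwards [h, hQM] with x h1 h2
    nlinarith
  have hMne : M ^ 2 / 2 ≠ L := by nlinarith [le_abs_self L, abs_nonneg L]
  have hup : ∀ᶠ x in 𝓝[<] (1 : ℝ), y x ≤ M :=
    (hside M hMne).resolve_right fun h => hfar (h.mono fun x hx => by gcongr)
  have hlow : ∀ᶠ x in 𝓝[<] (1 : ℝ), -M ≤ y x :=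
    (hside (-M) (by rwa [neg_sq])).resolve_left fun h => hfar (h.mono fun x hx => by nlinarith)
  refine tendsto_of_no_upcrossings dense_univ (fun a _ b _ hab => ?_)
    (isBoundedUnder_of_eventually_le hup) (isBoundedUnder_of_eventually_ge hlow)
  rintro ⟨h1, h2⟩
  -- Only the levels ±√(2L) lack a one-way barrier; any other m in (a, b) contradicts infinitely
  -- many crossings.
  obtain ⟨m, hm, hmL⟩ := (Ioo_infinite hab).exists_notMem_finite
    ((finite_singleton (-√(2 * L))).insert (√(2 * L)))
  have hmne : m ^ 2 / 2 ≠ L := by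
    rintro rfl
    rw [mul_div_cancel₀ _ two_ne_zero, Real.sqrt_sq_eq_abs] at hmL
    rcases abs_choice m with h | h <;> rw [h] at hmL <;> simp at hmL
  rcases hside m hmne with h | h
  · obtain ⟨x, hx, hx'⟩ := (h2.and_eventually h).exists
    linarith [hm.2]
  · obtain ⟨x, hx, hx'⟩ := (h1.and_eventually h).exists
    linarith [hm.1]

end

/-- The shift y = V + 2x completes the square, and 2 + P_c tends to 2 + 2c₂ at 1. -/
theorem IsRiccatiSolution.exists_tendsto_one {c : ℝ × ℝ × ℝ} {V : ℝ → ℝ}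
    (h : IsRiccatiSolution c V) : -1 ≤ c.2.1 ∧ ∃ l, Tendsto V (𝓝[<] 1) (𝓝 l) := by
  have hy : ∀ x ∈ Ioo (-1 : ℝ) 1, HasDerivAt (fun x => V x + 2 * x)
      ((2 + P c x - (V x + 2 * x) ^ 2 / 2) / (1 - x ^ 2)) x := fun x hx => by
    have := (h.hasDerivAt hx).add ((hasDerivAt_id x).const_mul 2)
    refine this.congr_deriv ?_
    have := one_sub_sq_pos hx
    field_simp
    ring
  have hQ : Tendsto (fun x => 2 + P c x) (𝓝[<] 1) (𝓝 (2 + P c 1)) := by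
    have : Continuous fun x => 2 + P c x := by unfold P; fun_prop
    exact (this.tendsto 1).mono_left nhdsWithin_le_nhds
  obtain ⟨hL, l, hl⟩ := exists_tendsto_left_of_one hy hQ
  refine ⟨?_, l - 2 * 1, ?_⟩
  · simp only [P] at hL
    linarith
  · have h2 : Tendsto (fun x : ℝ => 2 * x) (𝓝[<] 1) (𝓝 (2 * 1)) :=
      ((continuous_const.mul continuous_id).tendsto 1).mono_left nhdsWithin_le_nhds
    exact (hl.sub h2).congr fun x => by ring

theorem IsRiccatiSolution.exists_tendsto_neg_one {c : ℝ × ℝ × ℝ} {V : ℝ → ℝ}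
    (h : IsRiccatiSolution c V) : -1 ≤ c.1 ∧ ∃ l, Tendsto V (𝓝[>] (-1)) (𝓝 l) := by
  obtain ⟨h1, l, hl⟩ := h.reflect.exists_tendsto_one
  refine ⟨h1, -l, ?_⟩
  have hneg : Tendsto (fun x : ℝ => -x) (𝓝[>] (-1)) (𝓝[<] 1) := by
    simpa using tendsto_neg_nhdsGT (a := (-1 : ℝ))
  exact (hl.comp hneg).neg.congr fun x => by simp

/-- Every solution extends to a profile. -/
theorem IsRiccatiSolution.exists_isProfile {c : ℝ × ℝ × ℝ} {V : ℝ → ℝ}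
    (h : IsRiccatiSolution c V) :
    ∃ U : ℝ → ℝ, IsProfile c (V 0) U ∧ EqOn V U (Ioo (-1) 1) := by
  obtain ⟨-, l, hl⟩ := h.exists_tendsto_one
  obtain ⟨-, l', hl'⟩ := h.exists_tendsto_neg_one
  have heq : EqOn (extendFrom (Ioo (-1 : ℝ) 1) V) V (Ioo (-1) 1) := fun x hx =>
    extendFrom_eq (subset_closure hx)
      ((h.continuousOn x hx).tendsto)
  have hs := h.congr heq
  exact ⟨extendFrom (Ioo (-1 : ℝ) 1) V, ⟨hs.contDiffOn,
    continuousOn_Icc_extendFrom_Ioo h.continuousOn hl' hl, hs, heq (by norm_num)⟩, heq.symm⟩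

/-! ### The explicit solution and non-existence below c̄₃ -/

/-- The explicit solution with the least possible `c₃`. -/
noncomputable def explicitSolution (a b x : ℝ) : ℝ := (1 + a) * (1 - x) - (1 + b) * (1 + x)

theorem isRiccatiSolution_explicitSolution (a b : ℝ) :
    IsRiccatiSolution (a ^ 2 - 1, b ^ 2 - 1, -(1 / 2) * (a + b) * (a + b + 2))
      (explicitSolution a b) := by
  refine isRiccatiSolution_of_hasDerivAt fun x hx => ?_
  have := (((hasDerivAt_id x).const_sub 1).const_mul (1 + a)).sub
    (((hasDerivAt_id x).const_add 1).const_mul (1 + b))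
  refine this.congr_deriv ?_
  have := one_sub_sq_pos hx
  simp only [P, explicitSolution]
  field_simp
  ring

/-- The prescribed logarithmic derivative is (1 + a)/(1 + x) - (1 + b)/(1 - x), so S is a product of
powers. Because b ≥ 0, it vanishes at least linearly at 1. -/
theorem exists_integratingFactor {a b : ℝ} (hb : 0 ≤ b) :
    ∃ S : ℝ → ℝ, (∀ x ∈ Ioo (-1 : ℝ) 1, 0 < S x) ∧
      (∀ x ∈ Ioo (-1 : ℝ) 1,
        HasDerivAt S (S x * (explicitSolution a b x / (1 - x ^ 2))) x) ∧
      ∃ C > 0, ∀ x ∈ Ico (0 : ℝ) 1, S x ≤ C * (1 - x) := by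
  refine ⟨fun x => (1 + x) ^ (1 + a) * (1 - x) ^ (1 + b), fun x hx => ?_, fun x hx => ?_,
    2 ^ |1 + a|, by positivity, fun x hx => ?_⟩
  · have h1 : 0 < 1 + x := by linarith [hx.1]
    have h2 : 0 < 1 - x := by linarith [hx.2]
    positivity
  · have h1 : 0 < 1 + x := by linarith [hx.1]
    have h2 : 0 < 1 - x := by linarith [hx.2]
    have := (((hasDerivAt_id x).const_add 1).rpow_const (p := 1 + a) (Or.inl h1.ne')).mul
      (((hasDerivAt_id x).const_sub 1).rpow_const (p := 1 + b) (Or.inl h2.ne'))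
    refine this.congr_deriv ?_
    simp only [id, explicitSolution]
    rw [Real.rpow_sub_one h1.ne', Real.rpow_sub_one h2.ne',
      show 1 - x ^ 2 = (1 + x) * (1 - x) by ring]
    field_simp
    ring
  · have h1 : 1 ≤ 1 + x := by linarith [hx.1]
    have h2 : 0 < 1 - x := by linarith [hx.2]
    have h3 : (1 + x) ^ (1 + a) ≤ (2 : ℝ) ^ |1 + a| :=
      (Real.rpow_le_rpow_of_exponent_le h1 (le_abs_self _)).trans
        (Real.rpow_le_rpow (by linarith) (by linarith [hx.2]) (abs_nonneg _))
    have h4 : (1 - x) ^ (1 + b) ≤ 1 - x := by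
      calc (1 - x) ^ (1 + b) ≤ (1 - x) ^ (1 : ℝ) :=
            Real.rpow_le_rpow_of_exponent_ge h2 (by linarith [hx.1]) (by linarith)
        _ = 1 - x := Real.rpow_one _
    exact mul_le_mul h3 h4 (Real.rpow_nonneg h2.le _) (by positivity)

/-- The Wronskian Sφ' against the explicit solution is nonpositive at 0, where that solution equals
a - b, and strictly decreasing, so it is below a negative constant on [1/2, 1). With S ≤ C(1 - x)
this gives φ' ≤ -ε/(1 - x), contradicting φ > 0. -/
theorem not_isRiccatiSolution_of_value_le {a b c₃ : ℝ} (hb : 0 ≤ b)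
    (hc : c₃ < -(1 / 2) * (a + b) * (a + b + 2)) {V : ℝ → ℝ} (hV0 : V 0 ≤ a - b) :
    ¬ IsRiccatiSolution (a ^ 2 - 1, b ^ 2 - 1, c₃) V := by
  intro hV
  have h₀ := isRiccatiSolution_explicitSolution a b
  obtain ⟨S, hSpos, hS, C, hC, hSC⟩ := exists_integratingFactor (a := a) hb
  obtain ⟨φ, hφ0, hφpos, hφ⟩ :=
    exists_logDeriv (f := fun x => (V x - explicitSolution a b x) / (2 * (1 - x ^ 2)))
      (continuousOn_div_one_sub_sq (hV.continuousOn.sub h₀.continuousOn) 2 two_ne_zero)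
  have hG := fun x hx => hasDerivAt_wronskian (x := x) hx h₀ hV (hS x hx) (hφ x hx)
  set G := fun x => S x * (φ x * ((V x - explicitSolution a b x) / (2 * (1 - x ^ 2)))) with hGdef
  have hanti : StrictAntiOn G (Ioo (-1) 1) := by
    refine strictAntiOn_of_deriv_neg (convex_Ioo _ _)
      (fun x hx => (hG x hx).continuousAt.continuousWithinAt) fun x hx => ?_
    rw [interior_Ioo] at hx
    rw [(hG x hx).deriv]
    have h1 := one_sub_sq_pos hx
    have h2 := hSpos x hx
    have h3 := hφpos x
    refine div_neg_of_neg_of_pos (mul_neg_of_pos_of_neg (by positivity) ?_) (by positivity)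
    -- The two right-hand sides differ only in c₃, so P_c - P_{c₀} is a negative multiple of 1 - x².
    simp only [P]
    nlinarith
  have h0 : (0 : ℝ) ∈ Ioo (-1 : ℝ) 1 := by norm_num
  have hhalf : (1 / 2 : ℝ) ∈ Ioo (-1 : ℝ) 1 := by norm_num
  have hG0 : G 0 ≤ 0 := by
    have : V 0 - explicitSolution a b 0 ≤ 0 := by
      simp only [explicitSolution]
      linarith
    exact mul_nonpos_of_nonneg_of_nonpos (hSpos 0 h0).le (mul_nonpos_of_nonneg_of_nonpos
      (hφpos 0).le (div_nonpos_of_nonpos_of_nonneg this (by norm_num)))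
  have hGhalf : G (1 / 2) < 0 := (hanti h0 hhalf (by norm_num)).trans_le hG0
  have hsub : ∀ t ∈ Ico (1 / 2 : ℝ) 1, t ∈ Ioo (-1 : ℝ) 1 := fun t ht =>
    ⟨by linarith [ht.1], ht.2⟩
  refine false_of_deriv_le_neg_div (a := 1 / 2) (ε := -G (1 / 2) / C) (B := 0) (by norm_num)
    (div_pos (neg_pos.2 hGhalf) hC) (fun x hx => hφ x (hsub x hx)) (fun x hx => ?_)
    (fun x _ => (hφpos x).le)
  have hSx := hSpos x (hsub x hx)
  have h1 : 0 < 1 - x := sub_pos.2 hx.2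
  have h2 := hSC x ⟨by linarith [hx.1], hx.2⟩
  have h3 : G x ≤ G (1 / 2) := hanti.antitoneOn hhalf (hsub x hx) hx.1
  have h4 : φ x * ((V x - explicitSolution a b x) / (2 * (1 - x ^ 2))) = G x / S x := by
    rw [hGdef]
    field_simp
  have h5 : -(-G (1 / 2) / C) / (1 - x) = G (1 / 2) / (C * (1 - x)) := by
    field_simp
  rw [h4, h5, div_le_div_iff₀ hSx (by positivity)]
  nlinarith [mul_pos hC h1]

theorem IsRiccatiSolution.mem_J {c : ℝ × ℝ × ℝ} {V : ℝ → ℝ} (h : IsRiccatiSolution c V) :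
    c ∈ J := by
  have h2 := h.exists_tendsto_one.1
  have h1 := h.exists_tendsto_neg_one.1
  refine ⟨h1, h2, ?_⟩
  by_contra! hc
  have ha := Real.sq_sqrt (show 0 ≤ 1 + c.1 by linarith)
  have hb := Real.sq_sqrt (show 0 ≤ 1 + c.2.1 by linarith)
  have ha0 := Real.sqrt_nonneg (1 + c.1)
  have hb0 := Real.sqrt_nonneg (1 + c.2.1)
  simp only [cbar] at hc
  set a := √(1 + c.1)
  set b := √(1 + c.2.1)
  clear_value a b
  obtain ⟨c₁, c₂, c₃⟩ := c
  obtain rfl : c₁ = a ^ 2 - 1 := by simp only at ha; linarith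
  obtain rfl : c₂ = b ^ 2 - 1 := by simp only at hb; linarith
  rcases le_total (V 0) (a - b) with h0 | h0
  · exact not_isRiccatiSolution_of_value_le hb0 hc h0 h
  -- Reflection exchanges a and b and replaces V(0) by -V(0) ≤ b - a; the blow-up is then at the
  -- other pole.
  · refine not_isRiccatiSolution_of_value_le (a := b) (b := a) (c₃ := c₃) ha0
      (by rwa [add_comm b a]) ?_ h.reflect
    simp only [neg_zero]
    linarith

/-! ### The hypergeometric series -/

section PowerSeries

/-- The coefficients of the derivative of a power series. -/
noncomputable def derivCoeff (a : ℕ → ℝ) (n : ℕ) : ℝ := (n + 1) * a (n + 1)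

/-- Formal differentiation shifts the ratios and multiplies them by (n + 2)/(n + 1), so the limit 1
is preserved. -/
theorem tendsto_ratio_derivCoeff {a : ℕ → ℝ}
    (h : Tendsto (fun n => a (n + 1) / a n) atTop (𝓝 1)) :
    Tendsto (fun n => derivCoeff a (n + 1) / derivCoeff a n) atTop (𝓝 1) := by
  have h1 : Tendsto (fun n : ℕ => 1 + 1 / ((n : ℝ) + 1)) atTop (𝓝 (1 + 0)) :=
    tendsto_const_nhds.add tendsto_one_div_add_atTop_nhds_zero_nat
  have := h1.mul (h.comp (tendsto_add_atTop_nat 1))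
  rw [add_zero, one_mul] at this
  refine this.congr fun n => ?_
  have : (n : ℝ) + 1 ≠ 0 := by positivity
  simp only [derivCoeff, Function.comp]
  push_cast
  rw [mul_div_mul_comm]
  congr 1
  field_simp

theorem summable_of_tendsto_ratio {a : ℕ → ℝ} (ha : ∀ n, 0 < a n)
    (h : Tendsto (fun n => a (n + 1) / a n) atTop (𝓝 1)) {t : ℝ} (ht : t ∈ Ioo (0 : ℝ) 1) :
    Summable fun n => a n * t ^ n := by
  have hpos : ∀ n, 0 < a n * t ^ n := fun n => mul_pos (ha n) (pow_pos ht.1 n)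
  refine summable_of_ratio_test_tendsto_lt_one ht.2 (Eventually.of_forall fun n => (hpos n).ne') ?_
  have := h.mul_const t
  rw [one_mul] at this
  refine this.congr fun n => ?_
  rw [Real.norm_of_nonneg (hpos _).le, Real.norm_of_nonneg (hpos _).le, pow_succ]
  have := (ha n).ne'
  have := ht.1.ne'
  field_simp

theorem hasDerivAt_tsum_pow {a : ℕ → ℝ} (ha : ∀ n, 0 < a n)
    (h : Tendsto (fun n => a (n + 1) / a n) atTop (𝓝 1)) {t : ℝ} (ht : t ∈ Ioo (0 : ℝ) 1) :
    HasDerivAt (fun t => ∑' n, a n * t ^ n) (∑' n, derivCoeff a n * t ^ n) t := by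
  -- The derivative series at r dominates the termwise derivatives on (0, r) uniformly.
  obtain ⟨r, htr, hr⟩ := exists_between ht.2
  have hr0 : 0 < r := ht.1.trans htr
  have hb : ∀ n, 0 < derivCoeff a n := fun n => mul_pos (by positivity) (ha _)
  have hsum : ∀ t : ℝ, Summable (fun n => derivCoeff a n * t ^ n) →
      Summable (fun n : ℕ => a n * (n * t ^ (n - 1))) := fun t hs => by
    rw [← summable_nat_add_iff 1]
    refine hs.congr fun n => ?_
    simp only [derivCoeff, Nat.add_sub_cancel]
    push_cast
    ring
  have hsb := fun t ht => summable_of_tendsto_ratio hb (tendsto_ratio_derivCoeff h) (t := t) ht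
  have := hasDerivAt_tsum_of_isPreconnected (hsum r (hsb r ⟨hr0, hr⟩)) isOpen_Ioo
    (isPreconnected_Ioo (a := 0) (b := r)) (g := fun n t => a n * t ^ n)
    (g' := fun n t => a n * (n * t ^ (n - 1)))
    (fun n y _ => (hasDerivAt_pow n y).const_mul _) (fun n y hy => ?_) ⟨ht.1, htr⟩
    (summable_of_tendsto_ratio ha h ht) ⟨ht.1, htr⟩
  · refine this.congr_deriv ?_
    rw [(hsum t (hsb t ht)).tsum_eq_zero_add]
    simp only [Nat.cast_zero, zero_mul, mul_zero, zero_add, Nat.add_sub_cancel]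
    refine tsum_congr fun n => ?_
    simp only [derivCoeff]
    push_cast
    ring
  · have := ha n
    have := hy.1
    rw [Real.norm_of_nonneg (by positivity)]
    gcongr
    exact hy.2.le

/-- The Euler operator t d/dt multiplies the n-th coefficient by n. -/
theorem hasSum_mul_of_derivCoeff {a : ℕ → ℝ} {t s : ℝ}
    (h : HasSum (fun n => derivCoeff a n * t ^ n) s) :
    HasSum (fun n : ℕ => n * a n * t ^ n) (t * s) := by
  rw [← hasSum_nat_add_iff' 1]
  simp only [Finset.range_one, Finset.sum_singleton, Nat.cast_zero, zero_mul, sub_zero]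
  refine (h.mul_left t).congr_fun fun n => ?_
  simp only [derivCoeff]
  push_cast
  ring

/-- The coefficients of the hypergeometric series attached to the parameters `a`, `b`, `m`. -/
noncomputable def hypergeomCoeff (a b m : ℝ) : ℕ → ℝ
  | 0 => 1
  | n + 1 => hypergeomCoeff a b m n *
      ((n * (n - 1) + (2 + a + b) * n + m) / ((n + 1) * (n + 1 + a)))

theorem hypergeomCoeff_pos {a b m : ℝ} (ha : 0 ≤ a) (hb : 0 ≤ b) (hm : 0 < m) (n : ℕ) :
    0 < hypergeomCoeff a b m n := by
  induction n with
  | zero => exact one_pos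
  | succ n ih =>
    refine mul_pos ih (div_pos ?_ (by positivity))
    have : (n : ℝ) * (n - 1) + (2 + a + b) * n + m = n ^ 2 + (1 + a + b) * n + m := by ring
    rw [this]
    positivity

theorem tendsto_ratio_hypergeomCoeff {a b m : ℝ} (ha : 0 ≤ a) (hb : 0 ≤ b) (hm : 0 < m) :
    Tendsto (fun n => hypergeomCoeff a b m (n + 1) / hypergeomCoeff a b m n) atTop (𝓝 1) := by
  have hinv : Tendsto (fun n : ℕ => 1 / ((n : ℝ) + 1)) atTop (𝓝 0) :=
    tendsto_one_div_add_atTop_nhds_zero_nat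
  -- Numerator and denominator of the ratio are divided by (n + 1)² and written in powers of 1/(n +
  -- 1).
  have h1 : Tendsto (fun n : ℕ => (1 + (b + a - 1) * (1 / ((n : ℝ) + 1)) +
      (m - a - b) * (1 / ((n : ℝ) + 1)) ^ 2) / (1 + a * (1 / ((n : ℝ) + 1)))) atTop
      (𝓝 ((1 + (b + a - 1) * 0 + (m - a - b) * 0 ^ 2) / (1 + a * 0))) :=
    ((tendsto_const_nhds.add (hinv.const_mul _)).add ((hinv.pow 2).const_mul _)).div
      (tendsto_const_nhds.add (hinv.const_mul _)) (by norm_num)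
  have h2 : (1 + (b + a - 1) * 0 + (m - a - b) * 0 ^ 2) / (1 + a * 0) = 1 := by norm_num
  rw [h2] at h1
  refine h1.congr fun n => ?_
  have hn := (hypergeomCoeff_pos ha hb hm n).ne'
  have : (0 : ℝ) < (n : ℝ) + 1 := by positivity
  have : (0 : ℝ) < (n : ℝ) + 1 + a := by positivity
  rw [hypergeomCoeff, mul_div_cancel_left₀ _ hn]
  field_simp
  ring

/-- A positive solution of the hypergeometric equation on `(0,1)`. -/
theorem exists_hypergeom_solution {a b m : ℝ} (ha : 0 ≤ a) (hb : 0 ≤ b) (hm : 0 < m) :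
    ∃ v v' v'' : ℝ → ℝ, ∀ t ∈ Ioo (0 : ℝ) 1, 0 < v t ∧ HasDerivAt v (v' t) t ∧
      HasDerivAt v' (v'' t) t ∧
      t * (1 - t) * v'' t + ((1 + a) * (1 - t) - (1 + b) * t) * v' t = m * v t := by
  set α := hypergeomCoeff a b m with hα
  have hpos : ∀ n, 0 < α n := hypergeomCoeff_pos ha hb hm
  have hpos' : ∀ n, 0 < derivCoeff α n := fun n => mul_pos (by positivity) (hpos _)
  have hpos'' : ∀ n, 0 < derivCoeff (derivCoeff α) n := fun n => mul_pos (by positivity) (hpos' _)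
  have hr := tendsto_ratio_hypergeomCoeff ha hb hm
  have hr' := tendsto_ratio_derivCoeff hr
  have hr'' := tendsto_ratio_derivCoeff hr'
  refine ⟨fun t => ∑' n, α n * t ^ n, fun t => ∑' n, derivCoeff α n * t ^ n,
    fun t => ∑' n, derivCoeff (derivCoeff α) n * t ^ n, fun t ht =>
    ⟨(summable_of_tendsto_ratio hpos hr ht).tsum_pos
      (fun n => mul_nonneg (hpos n).le (pow_nonneg ht.1.le n)) 0 (by simpa using hpos 0),
    hasDerivAt_tsum_pow hpos hr ht, hasDerivAt_tsum_pow hpos' hr' ht, ?_⟩⟩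
  have s0 := (summable_of_tendsto_ratio hpos hr ht).hasSum
  have s1 := (summable_of_tendsto_ratio hpos' hr' ht).hasSum
  have s2 := (summable_of_tendsto_ratio hpos'' hr'' ht).hasSum
  set v0 := ∑' n, α n * t ^ n
  set v1 := ∑' n, derivCoeff α n * t ^ n
  set v2 := ∑' n, derivCoeff (derivCoeff α) n * t ^ n
  have e1 := hasSum_mul_of_derivCoeff s1
  have e2 := hasSum_mul_of_derivCoeff s2
  have e3 : HasSum (fun n : ℕ => n * ((n - 1) * α n) * t ^ n) (t * (t * v2)) := by
    refine hasSum_mul_of_derivCoeff (a := fun n => ((n : ℝ) - 1) * α n) ?_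
    refine e2.congr_fun fun n => ?_
    simp only [derivCoeff]
    push_cast
    ring
  have hl := e2.add (s1.mul_left (1 + a))
  have hrr := (e3.add (e1.mul_left (2 + a + b))).add (s0.mul_left m)
  -- Equality of n-th coefficients is the recursion defining `hypergeomCoeff`.
  have heq : t * v2 + (1 + a) * v1 = t * (t * v2) + (2 + a + b) * (t * v1) + m * v0 := by
    refine hl.unique ?_
    refine hrr.congr_fun fun n => ?_
    have h1 : (0 : ℝ) < (n : ℝ) + 1 := by positivity
    have h2 : (0 : ℝ) < (n : ℝ) + 1 + a := by positivity
    simp only [derivCoeff, hα, hypergeomCoeff]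
    field_simp
    ring
  linear_combination heq

end PowerSeries

/-! ### Existence on J and extremal solutions -/

/-- The correction to the explicit solution is 2(1 - x²) φ'/φ with φ(x) = v((1 + x)/2). The
hypergeometric equation with m = (c₃ - c̄₃)/2 raises c̄₃ to c₃, and v > 0 keeps the quotient finite
on all of (-1,1). -/
theorem exists_solution_of_le {a b c₃ : ℝ} (ha : 0 ≤ a) (hb : 0 ≤ b)
    (hc : -(1 / 2) * (a + b) * (a + b + 2) ≤ c₃) :
    ∃ V, IsRiccatiSolution (a ^ 2 - 1, b ^ 2 - 1, c₃) V := by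
  rcases hc.eq_or_lt with rfl | hlt
  · exact ⟨_, isRiccatiSolution_explicitSolution a b⟩
  obtain ⟨v, v', v'', hv⟩ := exists_hypergeom_solution ha hb
    (half_pos (sub_pos.2 hlt))
  refine ⟨fun x => explicitSolution a b x + (1 - x ^ 2) * (v' ((1 + x) / 2) / v ((1 + x) / 2)),
    isRiccatiSolution_of_hasDerivAt fun x hx => ?_⟩
  have ht : (1 + x) / 2 ∈ Ioo (0 : ℝ) 1 := ⟨by linarith [hx.1], by linarith [hx.2]⟩
  obtain ⟨h0, h1, h2, h3⟩ := hv _ ht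
  have hs : HasDerivAt (fun x : ℝ => (1 + x) / 2) (1 / 2) x :=
    ((hasDerivAt_id x).const_add 1).div_const 2
  have hp := one_sub_sq_pos hx
  have := ((isRiccatiSolution_explicitSolution a b).hasDerivAt hx).add
    (((hasDerivAt_pow 2 x).const_sub 1).mul
      ((h2.comp x hs).div (h1.comp x hs) h0.ne'))
  refine this.congr_deriv ?_
  simp only [Function.comp, Pi.div_apply]
  set w := v ((1 + x) / 2)
  set w' := v' ((1 + x) / 2)
  set w'' := v'' ((1 + x) / 2)
  have h4 : w'' = (2 * (c₃ - -(1 / 2) * (a + b) * (a + b + 2)) * w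
      - 2 * explicitSolution a b x * w') / (1 - x ^ 2) := by
    rw [eq_div_iff hp.ne']
    simp only [explicitSolution]
    linear_combination 4 * h3
  rw [h4]
  simp only [P, explicitSolution]
  field_simp
  ring

theorem exists_solution_of_mem_J {c : ℝ × ℝ × ℝ} (hc : c ∈ J) :
    ∃ V, IsRiccatiSolution c V := by
  obtain ⟨c₁, c₂, c₃⟩ := c
  obtain ⟨h1, h2, h3⟩ := hc
  simp only [cbar] at h1 h2 h3
  have ha := Real.sq_sqrt (show 0 ≤ 1 + c₁ by linarith)
  have hb := Real.sq_sqrt (show 0 ≤ 1 + c₂ by linarith)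
  have := exists_solution_of_le (Real.sqrt_nonneg _) (Real.sqrt_nonneg _) h3
  rwa [ha, hb, add_sub_cancel_left, add_sub_cancel_left] at this

/-- Every solvable equation has a greatest solution. -/
theorem exists_greatest_solution {c : ℝ × ℝ × ℝ} {V₀ : ℝ → ℝ} (h₀ : IsRiccatiSolution c V₀) :
    ∃ W, IsRiccatiSolution c W ∧
      ∀ V, IsRiccatiSolution c V → ∀ x ∈ Ioo (-1 : ℝ) 1, V x ≤ W x := by
  obtain ⟨h, σ, hh0, -, hmono, -, hσ, hsol, hall⟩ := exists_solution_family h₀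
  have h0 : (0 : ℝ) ∈ Ioo (-1 : ℝ) 1 := by norm_num
  have hneg : ∀ x ∈ Ioo (-1 : ℝ) 0, h x < 0 := fun x hx =>
    hh0 ▸ hmono ⟨hx.1, hx.2.trans one_pos⟩ h0 hx.2
  set K := {k : ℝ | ∀ x ∈ Ioo (-1 : ℝ) 1, 0 < 1 + k * h x} with hK
  have hK0 : (0 : ℝ) ∈ K := fun x _ => by simp
  have hub : ∀ x ∈ Ioo (-1 : ℝ) 0, ∀ k ∈ K, k ≤ 1 / -h x := fun x hx k hk => by
    rw [le_div_iff₀ (neg_pos.2 (hneg x hx))]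
    linarith [hk x ⟨hx.1, hx.2.trans one_pos⟩]
  have hbdd : BddAbove K := ⟨_, hub (-1 / 2) (by norm_num)⟩
  have hs0 : 0 ≤ sSup K := le_csSup hbdd hK0
  -- The supremum is attained: for x < 0 the weak inequality at some y in (-1, x) becomes strict at
  -- x, because h is strictly increasing.
  have hsup : sSup K ∈ K := fun x hx => by
    rcases le_or_gt 0 x with hx0 | hx0
    · have : 0 ≤ h x := hh0 ▸ hmono.monotoneOn h0 hx hx0
      positivity
    · obtain ⟨y, hy1, hy2⟩ := exists_between hx.1
      have hy : y ∈ Ioo (-1 : ℝ) 0 := ⟨hy1, hy2.trans hx0⟩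
      have h1 : h y < h x := hmono ⟨hy1, hy2.trans hx.2⟩ hx hy2
      have h2 : sSup K ≤ 1 / -h y := csSup_le ⟨0, hK0⟩ (hub y hy)
      rw [le_div_iff₀ (neg_pos.2 (hneg y hy))] at h2
      rcases hs0.eq_or_lt with h3 | h3
      · simp [← h3]
      · nlinarith
  refine ⟨_, hsol _ hsup, fun V hV x hx => ?_⟩
  obtain ⟨k, hk⟩ := hall V hV
  have hkK : k ∈ K := fun x hx => (hk x hx).1
  have hle := le_csSup hbdd hkK
  rw [(hk x hx).2]
  have h1 := one_sub_sq_pos hx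
  have h2 := hσ x
  -- k/(1 + k h) increases with k whatever the sign of h: after clearing denominators the terms with
  -- h cancel.
  gcongr _ + _ * ?_
  rw [div_le_div_iff₀ (hkK x hx) (hsup x hx)]
  linarith

theorem exists_least_solution {c : ℝ × ℝ × ℝ} {V₀ : ℝ → ℝ} (h₀ : IsRiccatiSolution c V₀) :
    ∃ W, IsRiccatiSolution c W ∧
      ∀ V, IsRiccatiSolution c V → ∀ x ∈ Ioo (-1 : ℝ) 1, W x ≤ V x := by
  obtain ⟨W, hW, hle⟩ := exists_greatest_solution h₀.reflect
  refine ⟨_, hW.reflect, fun V hV x hx => ?_⟩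
  have := hle _ hV.reflect (-x) ⟨by linarith [hx.2], by linarith [hx.1]⟩
  simp only [neg_neg] at this
  linarith

theorem Uplus_eq {c : ℝ × ℝ × ℝ} {W : ℝ → ℝ} (hW : IsRiccatiSolution c W)
    (hle : ∀ V, IsRiccatiSolution c V → ∀ x ∈ Ioo (-1 : ℝ) 1, V x ≤ W x) :
    EqOn (Uplus c) W (Ioo (-1) 1) := fun x hx =>
  IsGreatest.csSup_eq ⟨⟨W, hW, rfl⟩, fun _ ⟨V, hV, hy⟩ => hy ▸ hle V hV x hx⟩

theorem Uminus_eq {c : ℝ × ℝ × ℝ} {W : ℝ → ℝ} (hW : IsRiccatiSolution c W)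
    (hle : ∀ V, IsRiccatiSolution c V → ∀ x ∈ Ioo (-1 : ℝ) 1, W x ≤ V x) :
    EqOn (Uminus c) W (Ioo (-1) 1) := fun x hx =>
  IsLeast.csInf_eq ⟨⟨W, hW, rfl⟩, fun _ ⟨V, hV, hy⟩ => hy ▸ hle V hV x hx⟩

theorem isRiccatiSolution_Uplus {c : ℝ × ℝ × ℝ} (hc : c ∈ J) :
    IsRiccatiSolution c (Uplus c) ∧
      ∀ V, IsRiccatiSolution c V → ∀ x ∈ Ioo (-1 : ℝ) 1, V x ≤ Uplus c x := by
  obtain ⟨V₀, h₀⟩ := exists_solution_of_mem_J hc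
  obtain ⟨W, hW, hle⟩ := exists_greatest_solution h₀
  have heq := Uplus_eq hW hle
  exact ⟨hW.congr heq, fun V hV x hx => (hle V hV x hx).trans (heq hx).ge⟩

theorem isRiccatiSolution_Uminus {c : ℝ × ℝ × ℝ} (hc : c ∈ J) :
    IsRiccatiSolution c (Uminus c) ∧
      ∀ V, IsRiccatiSolution c V → ∀ x ∈ Ioo (-1 : ℝ) 1, Uminus c x ≤ V x := by
  obtain ⟨V₀, h₀⟩ := exists_solution_of_mem_J hc
  obtain ⟨W, hW, hle⟩ := exists_least_solution h₀
  have heq := Uminus_eq hW hle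
  exact ⟨hW.congr heq, fun V hV x hx => (heq hx).le.trans (hle V hV x hx)⟩

theorem IsRiccatiSolution.mem_I {c : ℝ × ℝ × ℝ} {V : ℝ → ℝ} (h : IsRiccatiSolution c V) :
    (c, V 0) ∈ I :=
  ⟨h.mem_J, (isRiccatiSolution_Uminus h.mem_J).2 V h 0 (by norm_num),
    (isRiccatiSolution_Uplus h.mem_J).2 V h 0 (by norm_num)⟩

/-- In the family based at W, the value at 0 is W(0) + 2k, so equal values force k = 0. -/
theorem IsRiccatiSolution.eqOn {c : ℝ × ℝ × ℝ} {V W : ℝ → ℝ} (hV : IsRiccatiSolution c V)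
    (hW : IsRiccatiSolution c W) (h0 : V 0 = W 0) : EqOn V W (Ioo (-1) 1) := by
  obtain ⟨h, σ, hh0, hσ0, -, -, -, -, hall⟩ := exists_solution_family hW
  obtain ⟨k, hk⟩ := hall V hV
  have hk0 : k = 0 := by
    have := (hk 0 (by norm_num)).2
    rw [hh0, hσ0, h0] at this
    norm_num at this
    exact this
  intro x hx
  rw [(hk x hx).2, hk0]
  simp

theorem exists_solution_of_mem_I {c : ℝ × ℝ × ℝ} {γ : ℝ} (h : (c, γ) ∈ I) :
    ∃ V, IsRiccatiSolution c V ∧ V 0 = γ := by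
  obtain ⟨hJ, hlo, hhi⟩ := h
  obtain ⟨h, σ, hh0, hσ0, -, -, -, hsol, hall⟩ :=
    exists_solution_family (isRiccatiSolution_Uminus hJ).1
  obtain ⟨k, hk⟩ := hall _ (isRiccatiSolution_Uplus hJ).1
  have hk0 := (hk 0 (by norm_num)).2
  rw [hh0, hσ0] at hk0
  norm_num at hk0
  simp only [gammaMinus, gammaPlus] at hlo hhi
  -- This parameter lies between 0, which gives U⁻, and k, which gives U⁺; 1 + k h is affine in k
  -- and positive at both ends.
  refine ⟨_, hsol ((γ - Uminus c 0) / 2) fun x hx => ?_, ?_⟩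
  · have h1 := (hk x hx).1
    rcases le_or_gt 0 (h x) with h2 | h2
    · have : 0 ≤ (γ - Uminus c 0) / 2 := by linarith
      positivity
    · have : (γ - Uminus c 0) / 2 ≤ k := by linarith
      nlinarith
  · simp only [hh0, hσ0]
    ring

theorem IsProfile.eqOn {c : ℝ × ℝ × ℝ} {γ : ℝ} {U V : ℝ → ℝ} (hU : IsProfile c γ U)
    (hV : IsProfile c γ V) : EqOn V U (Icc (-1) 1) := by
  have h := hV.solution.eqOn hU.solution (hV.value_zero.trans hU.value_zero.symm)
  rw [← closure_Ioo (show (-1 : ℝ) ≠ 1 by norm_num)] at *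
  refine h.of_subset_closure ?_ ?_ subset_closure subset_rfl
  · rw [closure_Ioo (show (-1 : ℝ) ≠ 1 by norm_num)]; exact hV.continuous
  · rw [closure_Ioo (show (-1 : ℝ) ≠ 1 by norm_num)]; exact hU.continuous

/-! ### Cartesian calculus of homogeneous axisymmetric fields -/

/-- The unit vector along the axis. -/
noncomputable def axis : E := EuclideanSpace.single 2 1

/-- `cos θ` as a function of the Cartesian coordinates. -/
noncomputable def cosAngle (x : E) : ℝ := x 2 * ‖x‖⁻¹

/-- The axisymmetric function `g(cos θ) / r ^ k`. -/
noncomputable def homog (g : ℝ → ℝ) (k : ℕ) (x : E) : ℝ := g (cosAngle x) * ‖x‖⁻¹ ^ k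

/-- The axisymmetric field `A(cos θ) x / r² - B(cos θ) e_z / r`. -/
noncomputable def axiField (A B : ℝ → ℝ) (x : E) : E := homog A 2 x • x - homog B 1 x • axis

theorem axis_zero : axis 0 = 0 := by simp [axis]

theorem axis_one : axis 1 = 0 := by simp [axis]

theorem axis_two : axis 2 = 1 := by simp [axis]

theorem norm_axis : ‖axis‖ = 1 := by simp [axis]

theorem inner_axis_left (x : E) : inner ℝ axis x = x 2 := by
  simp [axis, EuclideanSpace.inner_single_left]

theorem inner_axis_right (x : E) : inner ℝ x axis = x 2 := by
  rw [real_inner_comm, inner_axis_left]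

theorem isOpen_Domain : IsOpen Domain := by
  have h : ∀ i : Fin 3, IsOpen {x : E | x i ≠ 0} := fun i =>
    isOpen_ne_fun (by fun_prop) continuous_const
  exact (h 0).union (h 1)

theorem norm_sq_eq (x : E) : ‖x‖ ^ 2 = x 0 ^ 2 + x 1 ^ 2 + x 2 ^ 2 := by
  simp [EuclideanSpace.norm_sq_eq, Fin.sum_univ_three]

theorem ne_zero_of_mem_Domain {x : E} (hx : x ∈ Domain) : x ≠ 0 := by
  rintro rfl
  simp [Domain] at hx

theorem cosAngle_mem {x : E} (hx : x ∈ Domain) : cosAngle x ∈ Ioo (-1 : ℝ) 1 := by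
  have h0 : 0 < ‖x‖ := norm_pos_iff.2 (ne_zero_of_mem_Domain hx)
  have h1 := norm_sq_eq x
  have h2 : 0 < x 0 ^ 2 + x 1 ^ 2 := by
    rcases hx with h | h <;> positivity
  rw [mem_Ioo, ← abs_lt, cosAngle, ← div_eq_mul_inv, abs_div, abs_norm, div_lt_one h0]
  exact abs_lt_of_sq_lt_sq (by linarith) h0.le

/-- Off the axis x has a nonzero horizontal component, while `axis` has none. This independence
splits the momentum equation into two scalar equations. -/
theorem eq_zero_of_smul_add_smul_axis {x : E} (hx : x ∈ Domain) {α β : ℝ}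
    (h : α • x + β • axis = 0) : α = 0 ∧ β = 0 := by
  have hi : ∀ i : Fin 3, α * x i + β * axis i = 0 := fun i => by
    simpa using congrArg (fun v : E => v i) h
  have hα : α = 0 := by
    rcases hx with h | h
    · simpa [axis, h] using hi 0
    · simpa [axis, h] using hi 1
  exact ⟨hα, by simpa [axis, hα] using hi 2⟩

theorem hasFDerivAt_norm_inv {x : E} (hx : x ≠ 0) :
    HasFDerivAt (fun x : E => ‖x‖⁻¹) (innerSL ℝ (-(‖x‖⁻¹ ^ 3) • x)) x := by
  have h0 : 0 < ‖x‖ := norm_pos_iff.2 hx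
  have h1 : HasFDerivAt (fun x : E => ‖x‖ ^ 2) (2 • innerSL ℝ x) x :=
    (hasStrictFDerivAt_norm_sq x).hasFDerivAt
  have h2 := (hasDerivAt_inv (by positivity)).comp_hasFDerivAt x (h1.sqrt (by positivity))
  have h3 : (fun x : E => ‖x‖⁻¹) = Inv.inv ∘ fun x : E => √(‖x‖ ^ 2) := by
    funext y
    simp
  rw [h3]
  refine h2.congr_fderiv ?_
  ext v
  simp
  field_simp

theorem hasFDerivAt_cosAngle {x : E} (hx : x ≠ 0) :
    HasFDerivAt cosAngle (innerSL ℝ (‖x‖⁻¹ • axis - (cosAngle x * ‖x‖⁻¹ ^ 2) • x)) x := by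
  have h1 : HasFDerivAt (fun x : E => x 2) (innerSL ℝ axis) x := by
    have : (fun x : E => x 2) = innerSL ℝ axis := by
      funext y; simp [inner_axis_left]
    rw [this]
    exact (innerSL ℝ axis).hasFDerivAt
  refine (h1.mul (hasFDerivAt_norm_inv hx)).congr_fderiv ?_
  ext v
  simp [cosAngle]
  ring

theorem hasFDerivAt_homog {g : ℝ → ℝ} {g' : ℝ} {x : E} (k : ℕ) (hx : x ≠ 0)
    (hg : HasDerivAt g g' (cosAngle x)) :
    HasFDerivAt (homog g k) (innerSL ℝ ((g' * ‖x‖⁻¹ ^ (k + 1)) • axis -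
      ((g' * cosAngle x + k * g (cosAngle x)) * ‖x‖⁻¹ ^ (k + 2)) • x)) x := by
  have h1 := hg.comp_hasFDerivAt x (hasFDerivAt_cosAngle hx)
  have h2 := (hasFDerivAt_norm_inv hx).pow k
  refine (h1.mul h2).congr_fderiv ?_
  ext v
  rcases k with _ | k
  · simp
    ring
  · simp
    ring

/-- Allows the Laplacian to be computed from an explicit formula for the first derivative,
differentiated once more along each basis vector. -/
theorem laplacian_eq_sum {F : Type*} [NormedAddCommGroup F] [NormedSpace ℝ F] {f : E → F} {x : E}
    {f' : E → E →L[ℝ] F} {L : Fin 3 → E →L[ℝ] F} (v : OrthonormalBasis (Fin 3) ℝ E)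
    (hf : ContDiffAt ℝ 2 f x) (hf' : ∀ᶠ y in 𝓝 x, HasFDerivAt f (f' y) y)
    (hL : ∀ i, HasFDerivAt (fun y => f' y (v i)) (L i) x) :
    (Δ f) x = ∑ i, L i (v i) := by
  rw [InnerProductSpace.laplacian_eq_iteratedFDeriv_orthonormalBasis f v]
  refine Finset.sum_congr rfl fun i _ => ?_
  have hd : DifferentiableAt ℝ (fderiv ℝ f) x :=
    (hf.fderiv_right (m := 1) le_rfl).differentiableAt one_ne_zero
  rw [iteratedFDeriv_two_apply]
  have h1 : HasFDerivAt (fun y => fderiv ℝ f y (v i)) (L i) x :=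
    (hL i).congr_of_eventuallyEq (hf'.mono fun y hy => by simp only [hy.fderiv])
  have h2 := (hd.hasFDerivAt.clm_apply (hasFDerivAt_const (v i) x)).unique h1
  rw [← h2]
  simp

theorem contDiffAt_cosAngle {n : WithTop ℕ∞} {x : E} (hx : x ≠ 0) : ContDiffAt ℝ n cosAngle x := by
  unfold cosAngle
  exact ContDiffAt.mul (by fun_prop) ((contDiffAt_norm ℝ hx).inv (norm_ne_zero_iff.2 hx))

theorem contDiffAt_homog {n : WithTop ℕ∞} {g : ℝ → ℝ} (hg : ContDiffOn ℝ n g (Ioo (-1) 1))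
    (k : ℕ) {x : E} (hx : x ∈ Domain) : ContDiffAt ℝ n (homog g k) x := by
  have h0 := ne_zero_of_mem_Domain hx
  have h1 : ContDiffAt ℝ n g (cosAngle x) := hg.contDiffAt (isOpen_Ioo.mem_nhds (cosAngle_mem hx))
  exact (h1.comp x (contDiffAt_cosAngle h0)).mul
    (((contDiffAt_norm ℝ h0).inv (norm_ne_zero_iff.2 h0)).pow k)

theorem contDiffAt_axiField {n : WithTop ℕ∞} {A B : ℝ → ℝ} (hA : ContDiffOn ℝ n A (Ioo (-1) 1))
    (hB : ContDiffOn ℝ n B (Ioo (-1) 1)) {x : E} (hx : x ∈ Domain) :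
    ContDiffAt ℝ n (axiField A B) x :=
  ((contDiffAt_homog hA 2 hx).smul contDiffAt_id).sub
    ((contDiffAt_homog hB 1 hx).smul contDiffAt_const)

theorem gradient_homog {g : ℝ → ℝ} {g' : ℝ} {x : E} (k : ℕ) (hx : x ≠ 0)
    (hg : HasDerivAt g g' (cosAngle x)) :
    ∇ (homog g k) x = (g' * ‖x‖⁻¹ ^ (k + 1)) • axis -
      ((g' * cosAngle x + k * g (cosAngle x)) * ‖x‖⁻¹ ^ (k + 2)) • x := by
  refine HasGradientAt.gradient (hasGradientAt_iff_hasFDerivAt.2 ?_)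
  exact (hasFDerivAt_homog k hx hg).congr_fderiv (by ext; simp)

theorem apply_two_eq {x : E} (hx : x ≠ 0) : x 2 = cosAngle x * ‖x‖ := by
  rw [cosAngle, mul_assoc, inv_mul_cancel₀ (norm_ne_zero_iff.2 hx), mul_one]

theorem laplacian_homog {g g' g'' : ℝ → ℝ} (hgc : ContDiffOn ℝ 2 g (Ioo (-1) 1))
    (hg : ∀ y ∈ Ioo (-1 : ℝ) 1, HasDerivAt g (g' y) y)
    (hg' : ∀ y ∈ Ioo (-1 : ℝ) 1, HasDerivAt g' (g'' y) y) (k : ℕ) {x : E} (hx : x ∈ Domain) :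
    (Δ (homog g k)) x = ((1 - cosAngle x ^ 2) * g'' (cosAngle x) - 2 * cosAngle x * g' (cosAngle x)
      + k * (k - 1) * g (cosAngle x)) * ‖x‖⁻¹ ^ (k + 2) := by
  have h0 := ne_zero_of_mem_Domain hx
  have hy := cosAngle_mem hx
  have hβ := hasFDerivAt_homog (k + 1) h0 (hg' _ hy)
  have hα := hasFDerivAt_homog (g := fun y => g' y * y + k * g y) (k + 2) h0
    (((hg' _ hy).mul (hasDerivAt_id _)).add ((hg _ hy).const_mul _))
  set Gβ := (g'' (cosAngle x) * ‖x‖⁻¹ ^ (k + 1 + 1)) • axis -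
      ((g'' (cosAngle x) * cosAngle x + (k + 1 : ℕ) * g' (cosAngle x)) * ‖x‖⁻¹ ^ (k + 1 + 2)) • x
    with hGβ
  set α : E → ℝ := homog (fun y => g' y * y + k * g y) (k + 2) with hαdef
  rw [laplacian_eq_sum (EuclideanSpace.basisFun (Fin 3) ℝ) (contDiffAt_homog hgc k hx)
    (f' := fun y => innerSL ℝ (homog g' (k + 1) y • axis - α y • y))
    (by
      filter_upwards [isOpen_Domain.mem_nhds hx] with y hy
      exact hasFDerivAt_homog k (ne_zero_of_mem_Domain hy) (hg _ (cosAngle_mem hy)))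
    (fun i => by
      have := ((hβ.smul_const axis).sub (hα.smul (hasFDerivAt_id x))).inner ℝ
        (hasFDerivAt_const (EuclideanSpace.basisFun (Fin 3) ℝ i) x)
      exact this)]
  have h2 := apply_two_eq h0
  have hsq := norm_sq_eq x
  simp [Fin.sum_univ_three, inner_sub_left, inner_add_left, inner_smul_left, hGβ, axis_zero,
    axis_one, axis_two, EuclideanSpace.inner_single_right, hαdef, homog]
  have hn : ‖x‖ ≠ 0 := norm_ne_zero_iff.2 h0
  -- Eliminating x₀² and x₂ leaves an identity in ‖x‖ and `cosAngle x`.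
  have h3 : x 0 ^ 2 = ‖x‖ ^ 2 - x 1 ^ 2 - (cosAngle x * ‖x‖) ^ 2 := by
    rw [← h2]; linarith
  rw [h2]
  field_simp
  linear_combination (‖x‖ ^ (k + 1 + 1) * ‖x‖ ^ (k + 1 + 2) *
    (cosAngle x * (g'' (cosAngle x) * cosAngle x + g' (cosAngle x) + k * g' (cosAngle x)) +
      (cosAngle x * g' (cosAngle x) + k * g (cosAngle x)) * (k + 2))) * h3

/-- The identity map has no second derivative, so only the cross terms 2 ∂ᵢa eᵢ are added. -/
theorem laplacian_smul_id {a : E → ℝ} {x : E} (ha : ContDiffAt ℝ 2 a x) :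
    (Δ (fun y => a y • y)) x = (Δ a) x • x + (2 : ℝ) • ∇ a x := by
  set v := EuclideanSpace.basisFun (Fin 3) ℝ with hv
  have hd : ∀ᶠ y in 𝓝 x, DifferentiableAt ℝ a y :=
    (ha.eventually (by simp)).mono fun y hy => hy.differentiableAt two_ne_zero
  have hd2 : DifferentiableAt ℝ (fderiv ℝ a) x :=
    (ha.fderiv_right (m := 1) le_rfl).differentiableAt one_ne_zero
  have hlap : (Δ a) x = ∑ i, fderiv ℝ (fderiv ℝ a) x (v i) (v i) := by
    rw [InnerProductSpace.laplacian_eq_iteratedFDeriv_orthonormalBasis a v]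
    simp [iteratedFDeriv_two_apply]
  have hgrad : ∇ a x = ∑ i, fderiv ℝ a x (v i) • v i := by
    rw [← v.sum_repr (∇ a x)]
    refine Finset.sum_congr rfl fun i _ => ?_
    rw [v.repr_apply_apply, real_inner_comm, gradient, InnerProductSpace.toDual_symm_apply]
  rw [laplacian_eq_sum v (f := fun y => a y • y) (ha.smul contDiffAt_id)
    (hd.mono fun y hy => hy.hasFDerivAt.smul (hasFDerivAt_id y))
    (fun i => by
      have h1 := (hd2.hasFDerivAt.clm_apply (hasFDerivAt_const (v i) x)).smul (hasFDerivAt_id x)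
      exact (hd.self_of_nhds.hasFDerivAt.smul_const (v i)).add h1), hlap, hgrad]
  rw [Finset.sum_smul, Finset.smul_sum, ← Finset.sum_add_distrib]
  refine Finset.sum_congr rfl fun i _ => ?_
  simp
  module

section AxiField

variable {A A' A'' B B' B'' : ℝ → ℝ} {x : E}

theorem laplacian_axiField (hAc : ContDiffOn ℝ 2 A (Ioo (-1) 1))
    (hBc : ContDiffOn ℝ 2 B (Ioo (-1) 1))
    (hA : ∀ y ∈ Ioo (-1 : ℝ) 1, HasDerivAt A (A' y) y)
    (hA' : ∀ y ∈ Ioo (-1 : ℝ) 1, HasDerivAt A' (A'' y) y)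
    (hB : ∀ y ∈ Ioo (-1 : ℝ) 1, HasDerivAt B (B' y) y)
    (hB' : ∀ y ∈ Ioo (-1 : ℝ) 1, HasDerivAt B' (B'' y) y) (hx : x ∈ Domain) :
    (Δ (axiField A B)) x =
      (((1 - cosAngle x ^ 2) * A'' (cosAngle x) - 4 * cosAngle x * A' (cosAngle x)
        - 2 * A (cosAngle x)) * ‖x‖⁻¹ ^ 4) • x +
      ((2 * A' (cosAngle x) - (1 - cosAngle x ^ 2) * B'' (cosAngle x)
        + 2 * cosAngle x * B' (cosAngle x)) * ‖x‖⁻¹ ^ 3) • axis := by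
  have hca := contDiffAt_homog hAc 2 hx
  have hcb := contDiffAt_homog hBc 1 hx
  have h1 : axiField A B = (fun y => homog A 2 y • y) -
      ContinuousLinearMap.toSpanSingleton ℝ axis ∘ homog B 1 := by
    funext y
    simp [axiField]
  rw [h1, ContDiffAt.laplacian_sub (f₁ := fun y => homog A 2 y • y) (hca.smul contDiffAt_id)
    ((ContinuousLinearMap.contDiff _).contDiffAt.comp x hcb), laplacian_smul_id hca,
    hcb.laplacian_CLM_comp_left, Function.comp_apply, laplacian_homog hAc hA hA' 2 hx,
    laplacian_homog hBc hB hB' 1 hx,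
    gradient_homog 2 (ne_zero_of_mem_Domain hx) (hA _ (cosAngle_mem hx))]
  simp only [ContinuousLinearMap.toSpanSingleton_apply]
  push_cast
  module

theorem hasFDerivAt_axiField {a b : ℝ} (hx : x ≠ 0) (hA : HasDerivAt A a (cosAngle x))
    (hB : HasDerivAt B b (cosAngle x)) :
    HasFDerivAt (axiField A B)
      (homog A 2 x • ContinuousLinearMap.id ℝ E +
        (innerSL ℝ ((a * ‖x‖⁻¹ ^ 3) • axis -
          ((a * cosAngle x + 2 * A (cosAngle x)) * ‖x‖⁻¹ ^ 4) • x)).smulRight x -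
        (innerSL ℝ ((b * ‖x‖⁻¹ ^ 2) • axis -
          ((b * cosAngle x + B (cosAngle x)) * ‖x‖⁻¹ ^ 3) • x)).smulRight axis) x := by
  have h1 := ((hasFDerivAt_homog 2 hx hA).smul (hasFDerivAt_id x)).sub
    ((hasFDerivAt_homog 1 hx hB).smul_const axis)
  exact h1.congr_fderiv (by simp)

theorem fderiv_axiField_self {a b : ℝ} (hx : x ≠ 0) (hA : HasDerivAt A a (cosAngle x))
    (hB : HasDerivAt B b (cosAngle x)) :
    fderiv ℝ (axiField A B) x (axiField A B x) =
      ((-((1 - cosAngle x ^ 2) * B (cosAngle x)) * a + A (cosAngle x) ^ 2 -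
        2 * A (cosAngle x) * (A (cosAngle x) - cosAngle x * B (cosAngle x))) * ‖x‖⁻¹ ^ 4) • x +
      ((-(A (cosAngle x) * B (cosAngle x)) + (1 - cosAngle x ^ 2) * B (cosAngle x) * b +
        B (cosAngle x) * (A (cosAngle x) - cosAngle x * B (cosAngle x))) * ‖x‖⁻¹ ^ 3) • axis := by
  have hn : ‖x‖ ≠ 0 := norm_ne_zero_iff.2 hx
  rw [(hasFDerivAt_axiField hx hA hB).fderiv]
  simp only [axiField, homog, add_apply, sub_apply,
    smul_apply, ContinuousLinearMap.id_apply,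
    ContinuousLinearMap.smulRight_apply, innerSL_apply_apply, inner_sub_left, inner_sub_right,
    inner_smul_left, inner_smul_right, inner_axis_left, inner_axis_right, norm_axis,
    real_inner_self_eq_norm_sq, apply_two_eq hx, conj_trivial]
  generalize A (cosAngle x) = α
  generalize B (cosAngle x) = β
  generalize cosAngle x = y
  -- Coefficients of x and `axis` are compared separately; the unprimed pair is the raw expansion.
  have key : ∀ p q p' q' : ℝ, p = p' → q = q' → p • x + q • axis = p' • x + q' • axis := by
    rintro p q _ _ rfl rfl; rfl
  refine Eq.trans ?_ (key
    (α * ‖x‖⁻¹ ^ 2 * (α * ‖x‖⁻¹ ^ 2) +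
      (α * ‖x‖⁻¹ ^ 2 * (a * ‖x‖⁻¹ ^ 3 * (y * ‖x‖) - (a * y + 2 * α) * ‖x‖⁻¹ ^ 4 * ‖x‖ ^ 2) -
        β * ‖x‖⁻¹ ^ 1 * (a * ‖x‖⁻¹ ^ 3 - (a * y + 2 * α) * ‖x‖⁻¹ ^ 4 * (y * ‖x‖))))
    (-(α * ‖x‖⁻¹ ^ 2 * (β * ‖x‖⁻¹ ^ 1)) -
      (α * ‖x‖⁻¹ ^ 2 * (b * ‖x‖⁻¹ ^ 2 * (y * ‖x‖) - (b * y + β) * ‖x‖⁻¹ ^ 3 * ‖x‖ ^ 2) -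
        β * ‖x‖⁻¹ ^ 1 * (b * ‖x‖⁻¹ ^ 2 - (b * y + β) * ‖x‖⁻¹ ^ 3 * (y * ‖x‖)))) _ _ ?_ ?_)
  · module
  · field_simp
    ring
  · field_simp
    ring

theorem divergence_axiField {a b : ℝ} (hx : x ≠ 0) (hA : HasDerivAt A a (cosAngle x))
    (hB : HasDerivAt B b (cosAngle x)) :
    divergence (axiField A B) x =
      (A (cosAngle x) - (1 - cosAngle x ^ 2) * b + cosAngle x * B (cosAngle x)) * ‖x‖⁻¹ ^ 2 := by
  have hn : ‖x‖ ≠ 0 := norm_ne_zero_iff.2 hx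
  have h2 := apply_two_eq hx
  have h3 : x 0 ^ 2 = ‖x‖ ^ 2 - x 1 ^ 2 - (cosAngle x * ‖x‖) ^ 2 := by
    rw [← h2]; linarith [norm_sq_eq x]
  simp only [divergence, (hasFDerivAt_axiField hx hA hB).fderiv]
  simp [Fin.sum_univ_three, axis_zero, axis_one, axis_two, EuclideanSpace.inner_single_right, homog]
  rw [h2]
  field_simp
  linear_combination -(a * cosAngle x + A (cosAngle x) * 2) * h3

end AxiField

/-! ### The spherical frame -/

section Spherical

variable {r θ φ : ℝ}

theorem cos_mem_Ioo (hθ : θ ∈ Ioo 0 Real.pi) : Real.cos θ ∈ Ioo (-1 : ℝ) 1 := by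
  have h1 := Real.sin_pos_of_mem_Ioo hθ
  have h2 := Real.sin_sq_add_cos_sq θ
  constructor <;> nlinarith

theorem inner_eq_sum (v w : E) : inner ℝ v w = v 0 * w 0 + v 1 * w 1 + v 2 * w 2 := by
  simp [PiLp.inner_apply, Fin.sum_univ_three, mul_comm]

theorem norm_er : ‖er θ φ‖ = 1 := by
  rw [← sq_eq_sq₀ (norm_nonneg _) zero_le_one, norm_sq_eq]
  simp only [er, PiLp.toLp_apply, Matrix.cons_val]
  linear_combination Real.sin_sq_add_cos_sq θ + Real.sin θ ^ 2 * Real.sin_sq_add_cos_sq φ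

theorem inner_er_er : inner ℝ (er θ φ) (er θ φ) = 1 := by
  rw [real_inner_self_eq_norm_sq, norm_er, one_pow]

theorem inner_eθ_eθ : inner ℝ (eθ θ φ) (eθ θ φ) = 1 := by
  simp only [inner_eq_sum, eθ, Matrix.cons_val]
  linear_combination Real.sin_sq_add_cos_sq θ + Real.cos θ ^ 2 * Real.sin_sq_add_cos_sq φ

theorem inner_er_eθ : inner ℝ (er θ φ) (eθ θ φ) = 0 := by
  simp only [inner_eq_sum, er, eθ, Matrix.cons_val]
  linear_combination Real.sin θ * Real.cos θ * Real.sin_sq_add_cos_sq φ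

theorem inner_er_eφ : inner ℝ (er θ φ) (eφ θ φ) = 0 := by
  simp only [inner_eq_sum, er, eφ, Matrix.cons_val]
  ring

theorem inner_eθ_eφ : inner ℝ (eθ θ φ) (eφ θ φ) = 0 := by
  simp only [inner_eq_sum, eθ, eφ, Matrix.cons_val]
  ring

/-- Expansion of a vector in the spherical frame. -/
theorem eq_sum_spherical (v : E) : v = inner ℝ v (er θ φ) • er θ φ +
    inner ℝ v (eθ θ φ) • eθ θ φ + inner ℝ v (eφ θ φ) • eφ θ φ := by
  have h1 := Real.sin_sq_add_cos_sq θ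
  have h2 := Real.sin_sq_add_cos_sq φ
  have hs : Real.sin θ ^ 2 = 1 - Real.cos θ ^ 2 := by linarith
  have hs' : Real.sin φ ^ 2 = 1 - Real.cos φ ^ 2 := by linarith
  ext i
  fin_cases i <;>
  · simp [inner_eq_sum, er, eθ, eφ]
    ring_nf
    simp only [hs, hs']
    ring

theorem sin_smul_eθ : Real.sin θ • eθ θ φ = Real.cos θ • er θ φ - axis := by
  have h1 := Real.sin_sq_add_cos_sq θ
  ext i
  fin_cases i
  · simp [er, eθ, axis]; ring
  · simp [er, eθ, axis]; ring
  · simp [er, eθ, axis]; linarith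

theorem norm_smul_er (hr : 0 < r) : ‖r • er θ φ‖ = r := by
  rw [norm_smul, norm_er, mul_one, Real.norm_of_nonneg hr.le]

theorem cosAngle_smul_er (hr : 0 < r) : cosAngle (r • er θ φ) = Real.cos θ := by
  rw [cosAngle, norm_smul_er hr]
  simp [er]
  field_simp

theorem smul_er_mem (hr : 0 < r) (hθ : θ ∈ Ioo 0 Real.pi) : r • er θ φ ∈ Domain := by
  by_contra h
  simp only [Domain, mem_ofPred_eq, not_or, not_not] at h
  have h1 := Real.sin_pos_of_mem_Ioo hθ
  have h2 := Real.sin_sq_add_cos_sq φ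
  simp [er, hr.ne', h1.ne'] at h
  simp [h.1, h.2] at h2

theorem exists_spherical {x : E} (hx : x ∈ Domain) :
    ∃ r : ℝ, 0 < r ∧ ∃ θ ∈ Ioo 0 Real.pi, ∃ φ : ℝ, x = r • er θ φ := by
  have hn : 0 < ‖x‖ := norm_pos_iff.2 (ne_zero_of_mem_Domain hx)
  have hy := cosAngle_mem hx
  have h2 := apply_two_eq (ne_zero_of_mem_Domain hx)
  have hcos := Real.cos_arccos hy.1.le hy.2.le
  set z : ℂ := ⟨x 0, x 1⟩ with hz
  have hz0 : ‖z‖ = ‖x‖ * Real.sin (Real.arccos (cosAngle x)) := by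
    rw [← sq_eq_sq₀ (norm_nonneg _) (mul_nonneg hn.le (Real.sin_nonneg_of_nonneg_of_le_pi
      (Real.arccos_nonneg _) (Real.arccos_le_pi _))), mul_pow, Real.sin_sq, hcos, norm_sq_eq,
      Complex.sq_norm, Complex.normSq_apply]
    have := norm_sq_eq x
    rw [h2] at *
    simp only [hz]
    linear_combination -(cosAngle x ^ 2) * this
  refine ⟨‖x‖, hn, Real.arccos (cosAngle x), ⟨Real.arccos_pos.2 hy.2, ?_⟩, Complex.arg z, ?_⟩
  · exact lt_of_le_of_ne (Real.arccos_le_pi _) fun h => by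
      rw [Real.arccos_eq_pi] at h
      linarith [hy.1]
  · ext i
    fin_cases i
    · have := Complex.norm_mul_cos_arg z
      rw [hz0] at this
      simp only [er, Fin.zero_eta, Fin.isValue, PiLp.smul_apply, Matrix.cons_val, smul_eq_mul,
        ← mul_assoc, this]
      rfl
    · have := Complex.norm_mul_sin_arg z
      rw [hz0] at this
      simp only [er, Fin.mk_one, Fin.isValue, PiLp.smul_apply, Matrix.cons_val, smul_eq_mul,
        ← mul_assoc, this]
      rfl
    · simp [er, hcos, h2]
      ring

theorem axiField_smul_er {A B : ℝ → ℝ} (hr : 0 < r) :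
    axiField A B (r • er θ φ) =
      r⁻¹ • (A (Real.cos θ) • er θ φ - B (Real.cos θ) • axis) := by
  rw [axiField, homog, homog, cosAngle_smul_er hr, norm_smul_er hr, smul_sub, smul_smul, smul_smul,
    smul_smul]
  congr 2
  · field_simp
  · ring

end Spherical

/-! ### Fields generated by a profile -/

section Generated

variable {U U' U'' U''' : ℝ → ℝ} {θ : ℝ}

/-- The defining expression is -(sin θ u_θ)'/sin θ, and sin θ u_θ = U(cos θ). -/
theorem urOf_eq (h : HasDerivAt U (U' (Real.cos θ)) (Real.cos θ)) (hθ : θ ∈ Ioo 0 Real.pi) :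
    urOf U θ = U' (Real.cos θ) := by
  have hs := Real.sin_pos_of_mem_Ioo hθ
  have h1 : HasDerivAt (uθOf U) _ θ :=
    (h.comp θ (Real.hasDerivAt_cos θ)).div (Real.hasDerivAt_sin θ) hs.ne'
  rw [urOf, h1.deriv, uθOf, Real.cot_eq_cos_div_sin]
  simp only [Function.comp]
  field_simp
  ring

theorem pOf_eq (h : ∀ y ∈ Ioo (-1 : ℝ) 1, HasDerivAt U (U' y) y)
    (h' : ∀ y ∈ Ioo (-1 : ℝ) 1, HasDerivAt U' (U'' y) y)
    (h'' : ∀ y ∈ Ioo (-1 : ℝ) 1, HasDerivAt U'' (U''' y) y) (hθ : θ ∈ Ioo 0 Real.pi) :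
    pOf U θ = -(1 / 2) * ((1 - Real.cos θ ^ 2) * U''' (Real.cos θ) -
      2 * Real.cos θ * U'' (Real.cos θ) + U (Real.cos θ) * U'' (Real.cos θ) +
      U' (Real.cos θ) ^ 2 + U (Real.cos θ) ^ 2 / (1 - Real.cos θ ^ 2)) := by
  have hs := Real.sin_pos_of_mem_Ioo hθ
  have h1 : EqOn (urOf U) (U' ∘ Real.cos) (Ioo 0 Real.pi) := fun t ht =>
    urOf_eq (h _ (cos_mem_Ioo ht)) ht
  have h2 : EqOn (deriv (urOf U)) (fun t => U'' (Real.cos t) * -Real.sin t) (Ioo 0 Real.pi) :=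
    fun t ht => by
      rw [(h1.eventuallyEq_of_mem (isOpen_Ioo.mem_nhds ht)).deriv_eq]
      exact ((h' _ (cos_mem_Ioo ht)).comp t (Real.hasDerivAt_cos t)).deriv
  have h3 : deriv (deriv (urOf U)) θ =
      U''' (Real.cos θ) * -Real.sin θ * -Real.sin θ + U'' (Real.cos θ) * -Real.cos θ := by
    rw [(h2.eventuallyEq_of_mem (isOpen_Ioo.mem_nhds hθ)).deriv_eq]
    exact (((h'' _ (cos_mem_Ioo hθ)).comp θ (Real.hasDerivAt_cos θ)).mul
      (Real.hasDerivAt_sin θ).neg).deriv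
  have hsin : 1 - Real.cos θ ^ 2 = Real.sin θ ^ 2 := by linarith [Real.sin_sq_add_cos_sq θ]
  rw [pOf, h3, h2 hθ, h1 hθ, uθOf, Real.cot_eq_cos_div_sin, hsin]
  simp only [Function.comp]
  field_simp
  ring

/-- The fields generated by a profile, in Cartesian coordinates. -/
theorem isGeneratedBy_iff {A B q : ℝ → ℝ} (h : ∀ y ∈ Ioo (-1 : ℝ) 1, HasDerivAt U (U' y) y)
    (h' : ∀ y ∈ Ioo (-1 : ℝ) 1, HasDerivAt U' (U'' y) y)
    (h'' : ∀ y ∈ Ioo (-1 : ℝ) 1, HasDerivAt U'' (U''' y) y)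
    (hB : ∀ y ∈ Ioo (-1 : ℝ) 1, U y = (1 - y ^ 2) * B y)
    (hA : ∀ y ∈ Ioo (-1 : ℝ) 1, A y = U' y + y * B y)
    (hq : ∀ y ∈ Ioo (-1 : ℝ) 1, q y = -(1 / 2) * ((1 - y ^ 2) * U''' y -
      2 * y * U'' y + U y * U'' y + U' y ^ 2 + U y * B y)) (u : E → E) (p : E → ℝ) :
    IsGeneratedBy U u p ↔ EqOn u (axiField A B) Domain ∧ EqOn p (homog q 2) Domain := by
  have key : ∀ r > 0, ∀ θ ∈ Ioo 0 Real.pi, ∀ φ : ℝ,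
      axiField A B (r • er θ φ) = r⁻¹ • (urOf U θ • er θ φ + uθOf U θ • eθ θ φ) ∧
      homog q 2 (r • er θ φ) = (r ^ 2)⁻¹ * pOf U θ := by
    intro r hr θ hθ φ
    have hc := cos_mem_Ioo hθ
    have hs := Real.sin_pos_of_mem_Ioo hθ
    have hsin : 1 - Real.cos θ ^ 2 = Real.sin θ ^ 2 := by linarith [Real.sin_sq_add_cos_sq θ]
    constructor
    · rw [axiField_smul_er hr, urOf_eq (h _ hc) hθ, hA _ hc]
      have h1 : uθOf U θ • eθ θ φ =
          B (Real.cos θ) • (Real.cos θ • er θ φ - axis) := by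
        rw [← sin_smul_eθ, smul_smul, uθOf, hB _ hc, hsin]
        congr 1
        field_simp
      rw [h1]
      module
    · rw [homog, cosAngle_smul_er hr, norm_smul_er hr, hq _ hc, pOf_eq h h' h'' hθ, hB _ hc, hsin]
      field_simp
  constructor
  · refine fun hg => ⟨fun x hx => ?_, fun x hx => ?_⟩ <;>
      obtain ⟨r, hr, θ, hθ, φ, rfl⟩ := exists_spherical hx
    · exact (hg r hr θ hθ φ).1.trans (key r hr θ hθ φ).1.symm
    · exact (hg r hr θ hθ φ).2.trans (key r hr θ hθ φ).2.symm
  · rintro ⟨hu, hp⟩ r hr θ hθ φ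
    rw [hu (smul_er_mem hr hθ), hp (smul_er_mem hr hθ)]
    exact key r hr θ hθ φ

theorem IsGeneratedBy.isAxisymmetric {u : E → E} {p : E → ℝ} (h : IsGeneratedBy U u p) :
    IsAxisymmetric u := by
  intro r hr θ hθ φ φ'
  simp only [compR, compθ, compφ, (h r hr θ hθ _).1, inner_smul_left, inner_add_left, inner_er_er,
    inner_er_eθ, inner_er_eφ, inner_eθ_eφ, inner_eθ_eθ, real_inner_comm (er θ _) (eθ θ _), and_self]

theorem IsGeneratedBy.isNoSwirl {u : E → E} {p : E → ℝ} (h : IsGeneratedBy U u p) :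
    IsNoSwirl u := by
  intro r hr θ hθ φ
  simp [compφ, (h r hr θ hθ _).1, inner_smul_left, inner_add_left, inner_er_eφ, inner_eθ_eφ]

theorem IsGeneratedBy.homogeneous {u : E → E} {p : E → ℝ} (h : IsGeneratedBy U u p) {x : E}
    (hx : x ∈ Domain) {l : ℝ} (hl : 0 < l) :
    u (l • x) = l⁻¹ • u x ∧ p (l • x) = (l ^ 2)⁻¹ * p x := by
  obtain ⟨r, hr, θ, hθ, φ, rfl⟩ := exists_spherical hx
  rw [smul_smul, (h _ (mul_pos hl hr) θ hθ φ).1, (h _ (mul_pos hl hr) θ hθ φ).2,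
    (h r hr θ hθ φ).1, (h r hr θ hθ φ).2, smul_smul, mul_inv, mul_pow, mul_inv, mul_assoc]
  exact ⟨rfl, rfl⟩

end Generated

/-! ### The momentum equation as two scalar equations -/

section Momentum

variable {B B₁ B₂ B₃ q : ℝ → ℝ}

/-- The coefficient of the radial part that makes `axiField A B` divergence free. -/
noncomputable def radialCoeff (B B₁ : ℝ → ℝ) (y : ℝ) : ℝ := (1 - y ^ 2) * B₁ y - y * B y

theorem hasDerivAt_one_sub_sq (y : ℝ) : HasDerivAt (fun y : ℝ => 1 - y ^ 2) (-(2 * y)) y := by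
  simpa using (hasDerivAt_pow 2 y).const_sub 1

theorem hasDerivAt_radialCoeff {y : ℝ} (h₀ : HasDerivAt B (B₁ y) y)
    (h₁ : HasDerivAt B₁ (B₂ y) y) :
    HasDerivAt (radialCoeff B B₁) ((1 - y ^ 2) * B₂ y - 3 * y * B₁ y - B y) y := by
  refine (((hasDerivAt_one_sub_sq y).mul h₁).sub ((hasDerivAt_id y).mul h₀)).congr_deriv ?_
  simp only [id]
  ring

theorem hasDerivAt_deriv_radialCoeff {y : ℝ} (h₀ : HasDerivAt B (B₁ y) y)
    (h₁ : HasDerivAt B₁ (B₂ y) y) (h₂ : HasDerivAt B₂ (B₃ y) y) :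
    HasDerivAt (fun y => (1 - y ^ 2) * B₂ y - 3 * y * B₁ y - B y)
      ((1 - y ^ 2) * B₃ y - 5 * y * B₂ y - 4 * B₁ y) y := by
  refine ((((hasDerivAt_one_sub_sq y).mul h₂).sub
    (((hasDerivAt_id y).const_mul 3).mul h₁)).sub h₀).congr_deriv ?_
  simp only [id]
  ring

/-- The pressure coefficient that the radial part of the momentum equation prescribes. -/
noncomputable def pressureCoeff (B B₁ B₂ B₃ : ℝ → ℝ) (y : ℝ) : ℝ :=
  -(1 / 2) * ((1 - y ^ 2) * ((1 - y ^ 2) * B₃ y - 6 * y * B₂ y - 6 * B₁ y) -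
    2 * y * ((1 - y ^ 2) * B₂ y - 4 * y * B₁ y - 2 * B y) +
    (1 - y ^ 2) * B y * ((1 - y ^ 2) * B₂ y - 4 * y * B₁ y - 2 * B y) +
    ((1 - y ^ 2) * B₁ y - 2 * y * B y) ^ 2 + (1 - y ^ 2) * B y ^ 2)

/-- The derivative of the pressure coefficient according to the momentum equation. -/
noncomputable def pressureSlope (B B₁ B₂ : ℝ → ℝ) (y : ℝ) : ℝ :=
  (1 - y ^ 2) * B₂ y - 4 * y * B₁ y - 2 * B y + y * B y ^ 2 - (1 - y ^ 2) * B y * B₁ y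

/-- No pressure enters here. The gradient of q(cos θ)/r² is q' e_z/r³ - (cos θ q' + 2q) x/r⁴, and
the two coefficient functions are the values of q and q' that cancel the left side. -/
theorem neg_laplacian_add_convection
    (hBc : ContDiffOn ℝ 2 B (Ioo (-1) 1)) (hAc : ContDiffOn ℝ 2 (radialCoeff B B₁) (Ioo (-1) 1))
    (h₀ : ∀ y ∈ Ioo (-1 : ℝ) 1, HasDerivAt B (B₁ y) y)
    (h₁ : ∀ y ∈ Ioo (-1 : ℝ) 1, HasDerivAt B₁ (B₂ y) y)
    (h₂ : ∀ y ∈ Ioo (-1 : ℝ) 1, HasDerivAt B₂ (B₃ y) y) {u : E → E}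
    (hu : EqOn u (axiField (radialCoeff B B₁) B) Domain) {x : E} (hx : x ∈ Domain) :
    -(Δ u) x + fderiv ℝ u x (u x) =
      ((cosAngle x * pressureSlope B B₁ B₂ (cosAngle x) +
        2 * pressureCoeff B B₁ B₂ B₃ (cosAngle x)) * ‖x‖⁻¹ ^ 4) • x -
      (pressureSlope B B₁ B₂ (cosAngle x) * ‖x‖⁻¹ ^ 3) • axis := by
  have hy := cosAngle_mem hx
  have h0 := ne_zero_of_mem_Domain hx
  have he := hu.eventuallyEq_of_mem (isOpen_Domain.mem_nhds hx)
  rw [(InnerProductSpace.laplacian_congr_nhds he).eq_of_nhds, he.fderiv_eq, hu hx,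
    laplacian_axiField hAc hBc (fun y hy => hasDerivAt_radialCoeff (h₀ y hy) (h₁ y hy))
      (fun y hy => hasDerivAt_deriv_radialCoeff (h₀ y hy) (h₁ y hy) (h₂ y hy)) h₀ h₁ hx,
    fderiv_axiField_self h0 (hasDerivAt_radialCoeff (h₀ _ hy) (h₁ _ hy)) (h₀ _ hy)]
  simp only [radialCoeff, pressureSlope, pressureCoeff]
  module

/-- The coefficient of `axis` determines q'; the coefficient of x mixes q' and q, and then
determines q. -/
theorem momentum_iff
    (hBc : ContDiffOn ℝ 2 B (Ioo (-1) 1)) (hAc : ContDiffOn ℝ 2 (radialCoeff B B₁) (Ioo (-1) 1))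
    (h₀ : ∀ y ∈ Ioo (-1 : ℝ) 1, HasDerivAt B (B₁ y) y)
    (h₁ : ∀ y ∈ Ioo (-1 : ℝ) 1, HasDerivAt B₁ (B₂ y) y)
    (h₂ : ∀ y ∈ Ioo (-1 : ℝ) 1, HasDerivAt B₂ (B₃ y) y) {u : E → E} {p : E → ℝ}
    (hu : EqOn u (axiField (radialCoeff B B₁) B) Domain) (hp : EqOn p (homog q 2) Domain)
    {x : E} (hx : x ∈ Domain) {q₁ : ℝ} (hq : HasDerivAt q q₁ (cosAngle x)) :
    -(Δ u) x + fderiv ℝ u x (u x) + ∇ p x = 0 ↔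
      q (cosAngle x) = pressureCoeff B B₁ B₂ B₃ (cosAngle x) ∧
        q₁ = pressureSlope B B₁ B₂ (cosAngle x) := by
  have h0 := ne_zero_of_mem_Domain hx
  have hn : ‖x‖ ≠ 0 := norm_ne_zero_iff.2 h0
  have he := hp.eventuallyEq_of_mem (isOpen_Domain.mem_nhds hx)
  rw [neg_laplacian_add_convection hBc hAc h₀ h₁ h₂ hu hx, he.gradient_eq, gradient_homog 2 h0 hq]
  constructor
  · intro h
    have h3 : ((cosAngle x * (pressureSlope B B₁ B₂ (cosAngle x) - q₁) +
        2 * (pressureCoeff B B₁ B₂ B₃ (cosAngle x) - q (cosAngle x))) * ‖x‖⁻¹ ^ 4) • x +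
        ((q₁ - pressureSlope B B₁ B₂ (cosAngle x)) * ‖x‖⁻¹ ^ 3) • axis = 0 := by
      rw [← h]
      push_cast
      module
    obtain ⟨ha, hb⟩ := eq_zero_of_smul_add_smul_axis hx h3
    have hb' := (mul_eq_zero.1 hb).resolve_right (by positivity)
    have ha' := (mul_eq_zero.1 ha).resolve_right (by positivity)
    have h4 : q₁ = pressureSlope B B₁ B₂ (cosAngle x) := sub_eq_zero.1 hb'
    rw [h4] at ha'
    exact ⟨by linarith, h4⟩
  · rintro ⟨ha, rfl⟩
    rw [ha]
    push_cast
    module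

end Momentum

/-! ### The Riccati expression and the pressure -/

section RiccatiExpr

variable {B B₁ B₂ B₃ : ℝ → ℝ} {y : ℝ}

/-- The left side of the equation of Riccati type for `U = (1 - y²) B`. -/
noncomputable def riccatiExpr (B B₁ : ℝ → ℝ) (y : ℝ) : ℝ :=
  (1 - y ^ 2) ^ 2 * (B₁ y + 1 / 2 * B y ^ 2)

/-- The derivative of `riccatiExpr`. -/
noncomputable def riccatiExprDeriv (B B₁ B₂ : ℝ → ℝ) (y : ℝ) : ℝ :=
  -4 * y * (1 - y ^ 2) * (B₁ y + 1 / 2 * B y ^ 2) + (1 - y ^ 2) ^ 2 * (B₂ y + B y * B₁ y)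

/-- The second derivative of `riccatiExpr`. -/
noncomputable def riccatiExprDerivTwo (B B₁ B₂ B₃ : ℝ → ℝ) (y : ℝ) : ℝ :=
  (-4 + 12 * y ^ 2) * (B₁ y + 1 / 2 * B y ^ 2) - 8 * y * (1 - y ^ 2) * (B₂ y + B y * B₁ y) +
    (1 - y ^ 2) ^ 2 * (B₃ y + B₁ y ^ 2 + B y * B₂ y)

theorem hasDerivAt_riccatiExpr (h₀ : HasDerivAt B (B₁ y) y) (h₁ : HasDerivAt B₁ (B₂ y) y) :
    HasDerivAt (riccatiExpr B B₁) (riccatiExprDeriv B B₁ B₂ y) y := by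
  refine (((hasDerivAt_one_sub_sq y).pow 2).mul
    (h₁.add ((h₀.pow 2).const_mul (1 / 2)))).congr_deriv ?_
  simp [riccatiExprDeriv]
  ring

theorem hasDerivAt_riccatiExprDeriv (h₀ : HasDerivAt B (B₁ y) y) (h₁ : HasDerivAt B₁ (B₂ y) y)
    (h₂ : HasDerivAt B₂ (B₃ y) y) :
    HasDerivAt (riccatiExprDeriv B B₁ B₂) (riccatiExprDerivTwo B B₁ B₂ B₃ y) y := by
  refine (((((hasDerivAt_id y).const_mul (-4)).mul (hasDerivAt_one_sub_sq y)).mul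
    (h₁.add ((h₀.pow 2).const_mul (1 / 2)))).add
    (((hasDerivAt_one_sub_sq y).pow 2).mul (h₂.add (h₀.mul h₁)))).congr_deriv ?_
  simp [riccatiExprDerivTwo]
  ring

/-- The link between pressure and Riccati equation: the terms subtracted from the pressure
coefficient have derivative `pressureSlope` (`hasDerivAt_pressure_part`). So q' = `pressureSlope`
means that the third derivative of the Riccati expression vanishes. -/
theorem riccatiExprDerivTwo_eq : riccatiExprDerivTwo B B₁ B₂ B₃ y =
    -2 * (pressureCoeff B B₁ B₂ B₃ y - ((1 - y ^ 2) * B₁ y - 2 * y * B y) +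
      1 / 2 * ((1 - y ^ 2) * B y ^ 2)) := by
  simp only [riccatiExprDerivTwo, pressureCoeff]
  ring

/-- For U = (1 - y²) B, this lemma and the next two give U', U'' and U''', the combinations from
which `pressureCoeff` is built. -/
theorem hasDerivAt_one_sub_sq_mul (h₀ : HasDerivAt B (B₁ y) y) :
    HasDerivAt (fun y => (1 - y ^ 2) * B y) ((1 - y ^ 2) * B₁ y - 2 * y * B y) y :=
  ((hasDerivAt_one_sub_sq y).mul h₀).congr_deriv (by ring)

theorem hasDerivAt_one_sub_sq_mul_two (h₀ : HasDerivAt B (B₁ y) y)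
    (h₁ : HasDerivAt B₁ (B₂ y) y) :
    HasDerivAt (fun y => (1 - y ^ 2) * B₁ y - 2 * y * B y)
      ((1 - y ^ 2) * B₂ y - 4 * y * B₁ y - 2 * B y) y := by
  refine ((hasDerivAt_one_sub_sq_mul h₁).sub
    (((hasDerivAt_id y).const_mul 2).mul h₀)).congr_deriv ?_
  simp only [id]
  ring

theorem hasDerivAt_one_sub_sq_mul_three (h₀ : HasDerivAt B (B₁ y) y)
    (h₁ : HasDerivAt B₁ (B₂ y) y) (h₂ : HasDerivAt B₂ (B₃ y) y) :
    HasDerivAt (fun y => (1 - y ^ 2) * B₂ y - 4 * y * B₁ y - 2 * B y)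
      ((1 - y ^ 2) * B₃ y - 6 * y * B₂ y - 6 * B₁ y) y := by
  refine (((hasDerivAt_one_sub_sq_mul h₂).sub
    (((hasDerivAt_id y).const_mul 4).mul h₁)).sub (h₀.const_mul 2)).congr_deriv ?_
  simp only [id]
  ring

/-- The part of the pressure coefficient that is not constant. -/
theorem hasDerivAt_pressure_part (h₀ : HasDerivAt B (B₁ y) y) (h₁ : HasDerivAt B₁ (B₂ y) y) :
    HasDerivAt
      (fun y => (1 - y ^ 2) * B₁ y - 2 * y * B y - 1 / 2 * ((1 - y ^ 2) * B y ^ 2))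
      (pressureSlope B B₁ B₂ y) y := by
  refine ((hasDerivAt_one_sub_sq_mul_two h₀ h₁).sub
    (((hasDerivAt_one_sub_sq y).mul (h₀.pow 2)).const_mul (1 / 2))).congr_deriv ?_
  simp [pressureSlope]
  ring

theorem isGeneratedBy_iff_axiField {U : ℝ → ℝ}
    (hB : ∀ y ∈ Ioo (-1 : ℝ) 1, U y = (1 - y ^ 2) * B y)
    (h₀ : ∀ y ∈ Ioo (-1 : ℝ) 1, HasDerivAt B (B₁ y) y)
    (h₁ : ∀ y ∈ Ioo (-1 : ℝ) 1, HasDerivAt B₁ (B₂ y) y)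
    (h₂ : ∀ y ∈ Ioo (-1 : ℝ) 1, HasDerivAt B₂ (B₃ y) y) (u : E → E) (p : E → ℝ) :
    IsGeneratedBy U u p ↔ EqOn u (axiField (radialCoeff B B₁) B) Domain ∧
      EqOn p (homog (pressureCoeff B B₁ B₂ B₃) 2) Domain := by
  refine isGeneratedBy_iff
    (fun y hy => (hasDerivAt_one_sub_sq_mul (h₀ y hy)).congr_of_eventuallyEq
      (EqOn.eventuallyEq_of_mem hB (isOpen_Ioo.mem_nhds hy)))
    (fun y hy => hasDerivAt_one_sub_sq_mul_two (h₀ y hy) (h₁ y hy))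
    (fun y hy => hasDerivAt_one_sub_sq_mul_three (h₀ y hy) (h₁ y hy) (h₂ y hy)) hB
    (fun y hy => ?_) (fun y hy => ?_) u p
  · simp only [radialCoeff]
    ring
  · rw [hB y hy, pressureCoeff]
    ring

end RiccatiExpr

/-! ### From the Riccati equation to Navier-Stokes -/

section Profile

theorem contDiffOn_deriv {f : ℝ → ℝ} (hf : ContDiffOn ℝ ∞ f (Ioo (-1) 1)) :
    ContDiffOn ℝ ∞ (deriv f) (Ioo (-1) 1) ∧ ∀ y ∈ Ioo (-1 : ℝ) 1, HasDerivAt f (deriv f y) y :=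
  ⟨((contDiffOn_infty_iff_deriv_of_isOpen isOpen_Ioo).1 hf).2, fun y hy =>
    ((hf.contDiffAt (isOpen_Ioo.mem_nhds hy)).differentiableAt (by simp)).hasDerivAt⟩

theorem hasDerivAt_unique_of_eqOn {f g : ℝ → ℝ} {f' g' y : ℝ} (h : EqOn f g (Ioo (-1) 1))
    (hy : y ∈ Ioo (-1 : ℝ) 1) (hf : HasDerivAt f f' y) (hg : HasDerivAt g g' y) : f' = g' :=
  hf.unique (hg.congr_of_eventuallyEq (h.eventuallyEq_of_mem (isOpen_Ioo.mem_nhds hy)))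

variable {c : ℝ × ℝ × ℝ} {U B B₁ B₂ B₃ : ℝ → ℝ}

/-- The pressure coefficient of a solution of the equation of Riccati type. -/
theorem IsRiccatiSolution.pressureCoeff_eq (hU : IsRiccatiSolution c U)
    (hB : ∀ y ∈ Ioo (-1 : ℝ) 1, U y = (1 - y ^ 2) * B y)
    (h₀ : ∀ y ∈ Ioo (-1 : ℝ) 1, HasDerivAt B (B₁ y) y)
    (h₁ : ∀ y ∈ Ioo (-1 : ℝ) 1, HasDerivAt B₁ (B₂ y) y)
    (h₂ : ∀ y ∈ Ioo (-1 : ℝ) 1, HasDerivAt B₂ (B₃ y) y) {y : ℝ} (hy : y ∈ Ioo (-1 : ℝ) 1) :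
    pressureCoeff B B₁ B₂ B₃ y =
      ((1 - y ^ 2) * B₁ y - 2 * y * B y - 1 / 2 * ((1 - y ^ 2) * B y ^ 2)) + c.2.2 := by
  -- The identity F = P_c is differentiated twice, and P_c'' = -2c₃.
  have e0 : EqOn (riccatiExpr B B₁) (P c) (Ioo (-1) 1) := fun t ht => by
    have hd := hasDerivAt_unique_of_eqOn hB ht (hU.hasDerivAt ht)
      (hasDerivAt_one_sub_sq_mul (h₀ t ht))
    rw [div_eq_iff (one_sub_sq_pos ht).ne', hB t ht] at hd
    simp only [riccatiExpr]
    linear_combination -hd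
  have e1 : EqOn (riccatiExprDeriv B B₁ B₂) (fun t => c.2.1 - c.1 + -2 * c.2.2 * t)
      (Ioo (-1) 1) := fun t ht => by
    refine hasDerivAt_unique_of_eqOn e0 ht (hasDerivAt_riccatiExpr (h₀ t ht) (h₁ t ht)) ?_
    refine (((((hasDerivAt_id t).const_sub 1).const_mul c.1).add
      (((hasDerivAt_id t).const_add 1).const_mul c.2.1)).add
      ((hasDerivAt_one_sub_sq t).const_mul c.2.2)).congr_deriv ?_
    ring
  have e2 : riccatiExprDerivTwo B B₁ B₂ B₃ y = -2 * c.2.2 * 1 :=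
    hasDerivAt_unique_of_eqOn e1 hy (hasDerivAt_riccatiExprDeriv (h₀ y hy) (h₁ y hy) (h₂ y hy))
      (((hasDerivAt_id y).const_mul (-2 * c.2.2)).const_add _)
  rw [riccatiExprDerivTwo_eq] at e2
  linear_combination -(1 / 2) * e2

theorem IsRiccatiSolution.exists_quotient (hU : IsRiccatiSolution c U) :
    ∃ B : ℝ → ℝ, ContDiffOn ℝ ∞ B (Ioo (-1) 1) ∧ ∀ y ∈ Ioo (-1 : ℝ) 1, U y = (1 - y ^ 2) * B y :=
  ⟨fun y => U y / (1 - y ^ 2), hU.contDiffOn.div (by fun_prop) fun _ hy => (one_sub_sq_pos hy).ne',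
    fun y hy => by have := one_sub_sq_pos hy; field_simp⟩

/-- Solutions of the equation of Riccati type generate smooth Navier-Stokes solutions. -/
theorem IsRiccatiSolution.isNSSolution (hU : IsRiccatiSolution c U) :
    (∃ (u : E → E) (p : E → ℝ), IsGeneratedBy U u p) ∧
      ∀ (u : E → E) (p : E → ℝ), IsGeneratedBy U u p →
        IsNSSolution u p ∧ ContDiffOn ℝ ∞ u Domain ∧ ContDiffOn ℝ ∞ p Domain := by
  have htwo : (2 : WithTop ℕ∞) ≤ ∞ := WithTop.coe_le_coe.2 (le_top : (2 : ℕ∞) ≤ ⊤)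
  obtain ⟨B, hBc, hB⟩ := hU.exists_quotient
  obtain ⟨hB₁, h₀⟩ := contDiffOn_deriv hBc
  obtain ⟨hB₂, h₁⟩ := contDiffOn_deriv hB₁
  obtain ⟨hB₃, h₂⟩ := contDiffOn_deriv hB₂
  have hsq : ContDiffOn ℝ ∞ (fun y : ℝ => 1 - y ^ 2) (Ioo (-1) 1) := by fun_prop
  have hA : ContDiffOn ℝ ∞ (radialCoeff B (deriv B)) (Ioo (-1) 1) :=
    (hsq.mul hB₁).sub (contDiffOn_id.mul hBc)
  -- The coefficient equals a primitive of `pressureSlope` plus c₃, so the third derivative of B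
  -- need not be differentiated.
  have hqd : ∀ y ∈ Ioo (-1 : ℝ) 1,
      HasDerivAt (pressureCoeff B (deriv B) (deriv (deriv B)) (deriv (deriv (deriv B))))
        (pressureSlope B (deriv B) (deriv (deriv B)) y) y := fun y hy =>
    ((hasDerivAt_pressure_part (h₀ y hy) (h₁ y hy)).add_const c.2.2).congr_of_eventuallyEq
      (EqOn.eventuallyEq_of_mem (fun t ht => hU.pressureCoeff_eq hB h₀ h₁ h₂ ht)
        (isOpen_Ioo.mem_nhds hy))
  have hq : ContDiffOn ℝ ∞
      (pressureCoeff B (deriv B) (deriv (deriv B)) (deriv (deriv (deriv B)))) (Ioo (-1) 1) := by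
    refine ContDiffOn.congr ?_ fun y hy => hU.pressureCoeff_eq hB h₀ h₁ h₂ hy
    have hid : ContDiffOn ℝ ∞ (fun y : ℝ => 2 * y) (Ioo (-1) 1) := by fun_prop
    exact (((hsq.mul hB₁).sub (hid.mul hBc)).sub
      (contDiffOn_const.mul (hsq.mul (hBc.pow 2)))).add contDiffOn_const
  have hiff := isGeneratedBy_iff_axiField hB h₀ h₁ h₂
  refine ⟨⟨_, _, (hiff _ _).2 ⟨fun _ _ => rfl, fun _ _ => rfl⟩⟩, fun u p hup => ?_⟩
  obtain ⟨hu, hp⟩ := (hiff u p).1 hup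
  have hus : ContDiffOn ℝ ∞ u Domain :=
    ContDiffOn.congr (fun x hx => (contDiffAt_axiField hA hBc hx).contDiffWithinAt) hu
  have hps : ContDiffOn ℝ ∞ p Domain :=
    ContDiffOn.congr (fun x hx => (contDiffAt_homog hq 2 hx).contDiffWithinAt) hp
  refine ⟨⟨hus.of_le htwo, hps.of_le (one_le_two.trans htwo),
    fun x hx l hl => (hup.homogeneous hx hl).1, fun x hx l hl => (hup.homogeneous hx hl).2,
    hup.isAxisymmetric, hup.isNoSwirl, fun x hx => ?_, fun x hx => ?_⟩, hus, hps⟩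
  · exact (momentum_iff (hBc.of_le htwo) (hA.of_le htwo)
      h₀ h₁ h₂ hu hp hx (hqd _ (cosAngle_mem hx))).2 ⟨rfl, rfl⟩
  · have hy := cosAngle_mem hx
    have hdiv : divergence u x = divergence (axiField (radialCoeff B (deriv B)) B) x := by
      simp only [divergence,
        (hu.eventuallyEq_of_mem (isOpen_Domain.mem_nhds hx)).fderiv_eq]
    rw [hdiv, divergence_axiField (ne_zero_of_mem_Domain hx)
      (hasDerivAt_radialCoeff (h₀ _ hy) (h₁ _ hy)) (h₀ _ hy), radialCoeff]
    ring

end Profile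

/-! ### From Navier-Stokes to the Riccati equation -/

theorem contDiff_er {n : WithTop ℕ∞} : ContDiff ℝ n fun θ : ℝ => er θ 0 := by
  rw [contDiff_euclidean]
  intro i
  fin_cases i
  · simp only [er]; simpa using Real.contDiff_sin
  · simp only [er]; simpa using contDiff_const
  · simp only [er]; simpa using Real.contDiff_cos

theorem contDiff_eθ {n : WithTop ℕ∞} : ContDiff ℝ n fun θ : ℝ => eθ θ 0 := by
  rw [contDiff_euclidean]
  intro i
  fin_cases i
  · simp only [eθ]; simpa using Real.contDiff_cos
  · simp only [eθ]; simpa using contDiff_const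
  · simp only [eθ]; simpa using Real.contDiff_sin.neg

theorem er_mem_Domain {θ φ : ℝ} (hθ : θ ∈ Ioo 0 Real.pi) : er θ φ ∈ Domain := by
  simpa using smul_er_mem (φ := φ) one_pos hθ

theorem arccos_mem_Ioo {y : ℝ} (hy : y ∈ Ioo (-1 : ℝ) 1) : Real.arccos y ∈ Ioo 0 Real.pi :=
  ⟨Real.arccos_pos.2 hy.2, lt_of_le_of_ne (Real.arccos_le_pi _) fun h => by
    rw [Real.arccos_eq_pi] at h
    linarith [hy.1]⟩

theorem contDiffOn_arccos {n : WithTop ℕ∞} : ContDiffOn ℝ n Real.arccos (Ioo (-1) 1) :=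
  fun _ hy => (Real.contDiffAt_arccos hy.1.ne' hy.2.ne).contDiffWithinAt

/-- A meridian of the unit sphere, parametrized by `cos θ`. -/
noncomputable def meridian (y : ℝ) : E := er (Real.arccos y) 0

theorem meridian_mem {y : ℝ} (hy : y ∈ Ioo (-1 : ℝ) 1) : meridian y ∈ Domain :=
  er_mem_Domain (arccos_mem_Ioo hy)

theorem cosAngle_meridian {y : ℝ} (hy : y ∈ Ioo (-1 : ℝ) 1) : cosAngle (meridian y) = y := by
  have := cosAngle_smul_er (θ := Real.arccos y) (φ := 0) one_pos
  rwa [one_smul, Real.cos_arccos hy.1.le hy.2.le] at this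

theorem contDiffOn_meridian {n : WithTop ℕ∞} : ContDiffOn ℝ n meridian (Ioo (-1) 1) :=
  contDiff_er.comp_contDiffOn contDiffOn_arccos

theorem norm_meridian (y : ℝ) : ‖meridian y‖ = 1 := norm_er

/-- Homogeneous axisymmetric fields without swirl are of the form `axiField A B`. -/
theorem IsNSSolution.exists_axiField {u : E → E} {p : E → ℝ} (h : IsNSSolution u p) :
    ∃ A B : ℝ → ℝ, ContDiffOn ℝ 2 A (Ioo (-1) 1) ∧ ContDiffOn ℝ 2 B (Ioo (-1) 1) ∧
      EqOn u (axiField A B) Domain := by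
  have hsphere : ∀ θ ∈ Ioo 0 Real.pi, ∀ φ : ℝ, u (er θ φ) =
      compR u 1 θ 0 • er θ φ + compθ u 1 θ 0 • eθ θ φ := fun θ hθ φ => by
    have h1 := eq_sum_spherical (θ := θ) (φ := φ) (u (er θ φ))
    have h2 := h.axisymmetric 1 one_pos θ hθ 0 φ
    have h3 := h.noSwirl 1 one_pos θ hθ φ
    rw [h2.1, h2.2.1]
    simp only [compR, compθ, compφ, one_smul] at h3 ⊢
    rw [h3, zero_smul, add_zero] at h1
    exact h1
  have hum : ContDiffOn ℝ 2 (fun y => u (meridian y)) (Ioo (-1) 1) :=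
    h.u_contDiffOn.comp contDiffOn_meridian fun _ hy => meridian_mem hy
  have hf : ContDiffOn ℝ 2 (fun y => compR u 1 (Real.arccos y) 0) (Ioo (-1) 1) := by
    simp only [compR, one_smul]
    exact hum.inner ℝ contDiffOn_meridian
  have hg : ContDiffOn ℝ 2 (fun y => compθ u 1 (Real.arccos y) 0) (Ioo (-1) 1) := by
    simp only [compθ, one_smul]
    exact hum.inner ℝ (contDiff_eθ.comp_contDiffOn contDiffOn_arccos)
  have hB : ContDiffOn ℝ 2 (fun y => compθ u 1 (Real.arccos y) 0 / Real.sin (Real.arccos y))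
      (Ioo (-1) 1) :=
    hg.div (Real.contDiff_sin.comp_contDiffOn contDiffOn_arccos) fun y hy =>
      (Real.sin_pos_of_mem_Ioo (arccos_mem_Ioo hy)).ne'
  -- Substituting e_θ = (cos θ e_r - e_z)/sin θ gives B = u_θ/sin θ and A = u_r + cos θ B.
  refine ⟨_, _, hf.add (contDiffOn_id.mul hB), hB, fun x hx => ?_⟩
  obtain ⟨r, hr, θ, hθ, φ, rfl⟩ := exists_spherical hx
  have hs := Real.sin_pos_of_mem_Ioo hθ
  rw [h.u_homogeneous _ (er_mem_Domain hθ) r hr, hsphere θ hθ φ, axiField_smul_er hr]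
  simp only [id, Real.arccos_cos hθ.1.le hθ.2.le]
  have h1 : compθ u 1 θ 0 • eθ θ φ =
      (compθ u 1 θ 0 / Real.sin θ) • (Real.cos θ • er θ φ - axis) := by
    rw [← sin_smul_eθ, smul_smul, div_mul_cancel₀ _ hs.ne']
  rw [h1]
  module

/-- Euler's identity for the pressure. -/
theorem IsNSSolution.inner_gradient {u : E → E} {p : E → ℝ} (h : IsNSSolution u p) {x : E}
    (hx : x ∈ Domain) : inner ℝ (∇ p x) x = -2 * p x := by
  have hd : HasFDerivAt p (fderiv ℝ p x) ((1 : ℝ) • x) := by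
    rw [one_smul]
    exact ((h.p_contDiffOn.contDiffAt (isOpen_Domain.mem_nhds hx)).differentiableAt
      one_ne_zero).hasFDerivAt
  have h1 := hd.comp_hasDerivAt (1 : ℝ) ((hasDerivAt_id (1 : ℝ)).smul_const x)
  have h2 : HasDerivAt (fun l : ℝ => (l ^ 2)⁻¹ * p x) (-2 * p x) 1 := by
    refine (((hasDerivAt_pow 2 (1 : ℝ)).inv (by norm_num)).mul_const (p x)).congr_deriv ?_
    norm_num
  have h3 := h1.unique (h2.congr_of_eventuallyEq (by
    filter_upwards [lt_mem_nhds one_pos] with l hl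
    exact h.p_homogeneous x hx l hl))
  rw [one_smul] at h3
  rw [gradient, InnerProductSpace.toDual_symm_apply, h3]

/-- Every solution is generated by a solution of the equation of Riccati type. -/
theorem IsNSSolution.exists_isRiccatiSolution {u : E → E} {p : E → ℝ} (h : IsNSSolution u p) :
    ∃ (c : ℝ × ℝ × ℝ) (U : ℝ → ℝ), IsRiccatiSolution c U ∧
      ∀ V : ℝ → ℝ, EqOn U V (Ioo (-1) 1) → IsGeneratedBy V u p := by
  obtain ⟨A, B, hA, hB, huAB⟩ := h.exists_axiField
  have diff : ∀ {f : ℝ → ℝ} {n : WithTop ℕ∞}, ContDiffOn ℝ n f (Ioo (-1) 1) → n ≠ 0 →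
      ∀ y ∈ Ioo (-1 : ℝ) 1, HasDerivAt f (deriv f y) y := fun hf hn y hy =>
    ((hf.contDiffAt (isOpen_Ioo.mem_nhds hy)).differentiableAt hn).hasDerivAt
  have h₀ := diff hB two_ne_zero
  have hAeq : EqOn A (radialCoeff B (deriv B)) (Ioo (-1) 1) := fun y hy => by
    have hx := meridian_mem hy
    have hdiv := h.divFree _ hx
    have hcong : divergence u (meridian y) = divergence (axiField A B) (meridian y) := by
      simp only [divergence, (huAB.eventuallyEq_of_mem (isOpen_Domain.mem_nhds hx)).fderiv_eq]
    have hc := cosAngle_meridian hy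
    have hAd := diff hA two_ne_zero y hy
    have hBd := h₀ y hy
    rw [← hc] at hAd hBd
    rw [hcong, divergence_axiField (ne_zero_of_mem_Domain hx) hAd hBd, hc, norm_meridian] at hdiv
    simp only [radialCoeff]
    linear_combination hdiv
  have hsq : ContDiffOn ℝ 2 (fun y : ℝ => 1 - y ^ 2) (Ioo (-1) 1) := by fun_prop
  -- Incompressibility gains a derivative: B' = (A + yB)/(1 - y²) is C² because A and B are.
  have hB₁ : ContDiffOn ℝ 2 (deriv B) (Ioo (-1) 1) := by
    refine ((hA.add (contDiffOn_id.mul hB)).div hsq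
      fun y hy => (one_sub_sq_pos hy).ne').congr fun y hy => ?_
    have := one_sub_sq_pos hy
    simp only [Pi.div_apply, id]
    rw [eq_div_iff this.ne', hAeq hy, radialCoeff]
    ring
  have h₁ := diff hB₁ two_ne_zero
  have hB₂ : ContDiffOn ℝ 1 (deriv (deriv B)) (Ioo (-1) 1) :=
    ((contDiffOn_succ_iff_deriv_of_isOpen (n := 1) isOpen_Ioo).1 hB₁).2.2
  have h₂ := diff hB₂ one_ne_zero
  set B₁ := deriv B
  set B₂ := deriv B₁
  set B₃ := deriv B₂
  have hAc : ContDiffOn ℝ 2 (radialCoeff B B₁) (Ioo (-1) 1) := hA.congr hAeq.symm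
  have hu : EqOn u (axiField (radialCoeff B B₁) B) Domain := fun x hx => by
    simp only [huAB hx, axiField, homog, hAeq (cosAngle_mem hx)]
  -- In the inner product with x the slope terms cancel, and Euler's identity turns ∇p · x into -2p.
  -- This determines p before anything is known about the derivative of its coefficient.
  have hp : EqOn p (homog (pressureCoeff B B₁ B₂ B₃) 2) Domain := fun x hx => by
    have h0 := ne_zero_of_mem_Domain hx
    have hn : ‖x‖ ≠ 0 := norm_ne_zero_iff.2 h0
    have hm := congrArg (fun v => inner ℝ v x) (h.momentum x hx)
    simp only [neg_laplacian_add_convection hB hAc h₀ h₁ h₂ hu hx, inner_add_left, inner_sub_left,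
      inner_smul_left, h.inner_gradient hx, inner_axis_left, real_inner_self_eq_norm_sq,
      inner_zero_left, conj_trivial, apply_two_eq h0] at hm
    rw [homog]
    field_simp at hm ⊢
    linarith
  -- The formula contains B₃, so far only known to be continuous; the C¹ regularity is inherited
  -- from p along a meridian.
  have hqc : ContDiffOn ℝ 1 (pressureCoeff B B₁ B₂ B₃) (Ioo (-1) 1) := by
    refine (h.p_contDiffOn.comp contDiffOn_meridian fun _ hy => meridian_mem hy).congr
      fun y hy => ?_
    rw [Function.comp_apply, hp (meridian_mem hy), homog, cosAngle_meridian hy, norm_meridian]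
    norm_num
  have hq : ∀ y ∈ Ioo (-1 : ℝ) 1,
      HasDerivAt (pressureCoeff B B₁ B₂ B₃) (pressureSlope B B₁ B₂ y) y := fun y hy => by
    have hd := diff hqc one_ne_zero y hy
    have hc := cosAngle_meridian hy
    have hm := (momentum_iff hB hAc h₀ h₁ h₂ hu hp (meridian_mem hy) (hc.symm ▸ hd)).1
      (h.momentum _ (meridian_mem hy))
    rw [hc] at hm
    rw [← hm.2]
    exact hd
  -- F'' is -2(q - R), and q and R have the same derivative, so no fourth derivative of B is needed.
  have e2 : ∀ y ∈ Ioo (-1 : ℝ) 1,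
      riccatiExprDerivTwo B B₁ B₂ B₃ y = riccatiExprDerivTwo B B₁ B₂ B₃ 0 := fun y hy => by
    refine eq_of_hasDerivAt_zero (fun t ht => ?_) hy
    have hd := ((hq t ht).sub (hasDerivAt_pressure_part (h₀ t ht) (h₁ t ht))).const_mul (-2)
    rw [sub_self, mul_zero] at hd
    refine hd.congr_of_eventuallyEq (Eventually.of_forall fun t => ?_)
    rw [riccatiExprDerivTwo_eq]
    simp only [Pi.sub_apply]
    ring
  set k₂ := riccatiExprDerivTwo B B₁ B₂ B₃ 0
  have e1 : ∀ y ∈ Ioo (-1 : ℝ) 1,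
      riccatiExprDeriv B B₁ B₂ y = riccatiExprDeriv B B₁ B₂ 0 + k₂ * y := fun y hy => by
    have := eq_of_hasDerivAt_zero (f := fun y => riccatiExprDeriv B B₁ B₂ y - k₂ * y)
      (fun t ht => ((hasDerivAt_riccatiExprDeriv (h₀ t ht) (h₁ t ht) (h₂ t ht)).sub
        ((hasDerivAt_id t).const_mul k₂)).congr_deriv (by rw [e2 t ht]; ring)) hy
    linarith
  set k₁ := riccatiExprDeriv B B₁ B₂ 0
  have e0 : ∀ y ∈ Ioo (-1 : ℝ) 1,
      riccatiExpr B B₁ y = riccatiExpr B B₁ 0 + k₁ * y + k₂ / 2 * y ^ 2 := fun y hy => by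
    have := eq_of_hasDerivAt_zero (f := fun y => riccatiExpr B B₁ y - k₁ * y - k₂ / 2 * y ^ 2)
      (fun t ht => (((hasDerivAt_riccatiExpr (h₀ t ht) (h₁ t ht)).sub
        ((hasDerivAt_id t).const_mul k₁)).sub
          ((hasDerivAt_pow 2 t).const_mul (k₂ / 2))).congr_deriv
            (by rw [e1 t ht]; push_cast; ring)) hy
    linarith
  set k₀ := riccatiExpr B B₁ 0
  -- These are the coordinates of k₀ + k₁ y + (k₂/2) y² in the basis 1 - y, 1 + y, 1 - y².
  refine ⟨((k₀ + k₂ / 2 - k₁) / 2, (k₀ + k₂ / 2 + k₁) / 2, -k₂ / 2), fun y => (1 - y ^ 2) * B y,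
    isRiccatiSolution_of_hasDerivAt fun y hy => ?_, fun V hV => ?_⟩
  · refine (hasDerivAt_one_sub_sq_mul (h₀ y hy)).congr_deriv ?_
    have he := e0 y hy
    rw [eq_div_iff (one_sub_sq_pos hy).ne', P]
    simp only [riccatiExpr] at he
    linear_combination he
  · exact (isGeneratedBy_iff_axiField (fun y hy => (hV hy).symm) h₀ h₁ h₂ u p).2 ⟨hu, hp⟩

end NSAxi

end

open NSAxi in
theorem theorem1p2 :
    -- `U⁺(c)` and `U⁻(c)` are the greatest and the least solution for `c ∈ J`
    (∀ c ∈ J, IsRiccatiSolution c (Uplus c) ∧ IsRiccatiSolution c (Uminus c) ∧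
      ∀ V : ℝ → ℝ, IsRiccatiSolution c V →
        ∀ x ∈ Set.Ioo (-1 : ℝ) 1, Uminus c x ≤ V x ∧ V x ≤ Uplus c x) ∧
    -- existence and uniqueness of `U^{c,γ}`
    (∀ (c : ℝ × ℝ × ℝ) (γ : ℝ), (c, γ) ∈ I →
      ∃ U : ℝ → ℝ, IsProfile c γ U ∧
        ∀ V : ℝ → ℝ, IsProfile c γ V → Set.EqOn V U (Set.Icc (-1) 1)) ∧
    -- every solution of the equation, for any `c ∈ ℝ³`, is one of the `U^{c,γ}`
    (∀ (c : ℝ × ℝ × ℝ) (V : ℝ → ℝ), IsRiccatiSolution c V →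
      (c, V 0) ∈ I ∧
        ∃ U : ℝ → ℝ, IsProfile c (V 0) U ∧ Set.EqOn V U (Set.Ioo (-1) 1)) ∧
    -- there is no solution outside of `J`
    (∀ c : ℝ × ℝ × ℝ, (∃ V : ℝ → ℝ, IsRiccatiSolution c V) →
      -1 ≤ c.1 ∧ -1 ≤ c.2.1 ∧ ¬ c.2.2 < cbar c.1 c.2.1) ∧
    -- each `U^{c,γ}` generates a Navier-Stokes solution, smooth off the axis
    (∀ (c : ℝ × ℝ × ℝ) (γ : ℝ), (c, γ) ∈ I → ∀ U : ℝ → ℝ, IsProfile c γ U →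
      (∃ (u : E → E) (p : E → ℝ), IsGeneratedBy U u p) ∧
      ∀ (u : E → E) (p : E → ℝ), IsGeneratedBy U u p →
        IsNSSolution u p ∧ ContDiffOn ℝ ∞ u Domain ∧ ContDiffOn ℝ ∞ p Domain) ∧
    -- there are no other Navier-Stokes solutions of this kind
    (∀ (u : E → E) (p : E → ℝ), IsNSSolution u p →
      ∃ (c : ℝ × ℝ × ℝ) (γ : ℝ), (c, γ) ∈ I ∧
        ∃ U : ℝ → ℝ, IsProfile c γ U ∧ IsGeneratedBy U u p) := by
  refine ⟨fun c hc => ?_, fun c γ hI => ?_, fun c V hV => ⟨hV.mem_I, hV.exists_isProfile⟩,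
    fun c ⟨V, hV⟩ => ⟨hV.mem_J.1, hV.mem_J.2.1, hV.mem_J.2.2.not_gt⟩,
    fun c γ _ U hU => hU.solution.isNSSolution, fun u p h => ?_⟩
  · obtain ⟨h1, h2⟩ := isRiccatiSolution_Uplus hc
    obtain ⟨h3, h4⟩ := isRiccatiSolution_Uminus hc
    exact ⟨h1, h3, fun V hV x hx => ⟨h4 V hV x hx, h2 V hV x hx⟩⟩
  · obtain ⟨V, hV, rfl⟩ := exists_solution_of_mem_I hI
    obtain ⟨U, hU, -⟩ := hV.exists_isProfile
    exact ⟨U, hU, fun W hW => hU.eqOn hW⟩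
  · obtain ⟨c, V, hV, hgen⟩ := h.exists_isRiccatiSolution
    obtain ⟨U, hU, hVU⟩ := hV.exists_isProfile
    -- The continuous extension U may differ from V at ±1 and beyond, but generation only sees
    -- values on (-1,1).
    exact ⟨c, V 0, hV.mem_I, U, hU, hgen U hVU⟩
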